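/- For a finite simple graph $G$ with vertex set $V(G)\neq\emptyset$ let $\alpha(G)$ be its independence number, $r(G)=\alpha(G)/|V(G)|$, and let $G^k$ be the $k$-fold categorical (tensor) product of $G$: its vertices are the $k$-tuples of vertices of $G$, and two tuples are adjacent if and only if they are adjacent in every coordinate. The tensor capacity of $G$ is $$\Theta^T(G)=\lim_{k\to\infty} r(G^k).$$ Let also $$a(G)=\max_{I}\frac{|I|}{|I|+|N(I)|},$$ the maximum over the nonempty independent sets $I$ of $G$, where $N(I)$ is the set of vertices that have a neighbour in $I$. A permutation graph is the intersection graph of the straight line segments of a permutation diagram: given two horizontal lines, on each of which $n$ distinct points are labelled $1,\dots,n$, take for each label $i$ the segment that joins the two points labelled $i$. Theorem. There is an algorithm (a single program for a random access machine with words of $O(\log n)$ bits and unit-cost operations) that, given the adjacency matrix of a permutation graph $G$ with $n\ge 1$ vertices, computes $a(G)$ and $\Theta^T(G)$, each as a fraction of two natural numbers, in $O(n^3)$ time. In particular the limit $\Theta^T(G)$ exists and is rational. -/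

import Mathlib

open Filter Topology

/-! ### Tensor capacity -/

namespace SimpleGraph

variable {V : Type*}

/-- The `k`-fold categorical (tensor) product `G × ⋯ × G`: its vertices are the `k`-tuples of
vertices of `G`, and two tuples are adjacent when they are adjacent in every coordinate.
(The clause `x ≠ y` is automatic for `k ≥ 1`; for `k = 0` it makes the power a single vertex
without an edge.) -/
def tensorPower (G : SimpleGraph V) (k : ℕ) : SimpleGraph (Fin k → V) where
  Adj x y := x ≠ y ∧ ∀ i, G.Adj (x i) (y i)
  symm := ⟨fun _ _ h => ⟨h.1.symm, fun i => (h.2 i).symm⟩⟩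
  loopless := ⟨fun _ h => h.1 rfl⟩

/-- The independence ratio `r(G) = α(G) / |V(G)|`. -/
noncomputable def indepRatio (G : SimpleGraph V) : ℝ :=
  (G.indepNum : ℝ) / (Nat.card V : ℝ)

/-- `θ` is the tensor capacity of `G`, that is, the limit of `r(G^k)` for `k → ∞`
(the ultimate categorical independence ratio). -/
def IsTensorCapacity (G : SimpleGraph V) (θ : ℝ) : Prop :=
  Tendsto (fun k : ℕ => (G.tensorPower k).indepRatio) atTop (𝓝 θ)

/-- The neighbourhood `N(I)` of a set `I` of vertices. -/
def nbhd (G : SimpleGraph V) (I : Set V) : Set V := {v | ∃ u ∈ I, G.Adj u v}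

/-- `a` is the maximum `a(G)` of `|I| / (|I| + |N(I)|)` over the nonempty independent sets `I`
of `G`. -/
def IsMaxNbhdRatio (G : SimpleGraph V) (a : ℝ) : Prop :=
  IsGreatest {q : ℝ | ∃ I : Set V, I.Nonempty ∧ G.IsIndepSet I ∧
    q = (I.ncard : ℝ) / ((I.ncard : ℝ) + ((G.nbhd I).ncard : ℝ))} a

/-- `G` is a permutation graph: the intersection graph of the straight line segments of a
permutation diagram. The segment of a vertex `v` joins the point `top v` of the horizontal line
`y = 1` to the point `bot v` of the horizontal line `y = 0`, and different vertices have
different points on each of the two lines. -/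
def IsPermutationGraph (G : SimpleGraph V) : Prop :=
  ∃ top bot : V → ℝ, Function.Injective top ∧ Function.Injective bot ∧
    ∀ u v, G.Adj u v ↔ u ≠ v ∧
      (segment ℝ ((top u, 1) : ℝ × ℝ) (bot u, 0) ∩
        segment ℝ ((top v, 1) : ℝ × ℝ) (bot v, 0)).Nonempty

end SimpleGraph

/-! ### Random access machines

A structured random access machine: a program is a finite text that uses finitely many scalar
variables and finitely many arrays of natural numbers, all named by numbers. Arithmetic
operations, comparisons, array accesses, assignments and tests cost one step each. -/

namespace RAM

/-- The memory: `var x` is the content of the scalar variable `x`, and `arr a i` is the content of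
cell `i` of the array `a`. -/
structure State where
  var : ℕ → ℕ
  arr : ℕ → ℕ → ℕ

/-- Expressions. -/
inductive Expr where
  | const (k : ℕ)
  | var (x : ℕ)
  | read (a : ℕ) (i : Expr)
  | add (e f : Expr)
  | sub (e f : Expr)
  | mul (e f : Expr)
  | lt (e f : Expr)

namespace Expr

/-- The value of an expression; `sub` is truncated and `lt` has the value `1` or `0`. -/
def eval (s : State) : Expr → ℕ
  | const k => k
  | var x => s.var x
  | read a i => s.arr a (i.eval s)
  | add e f => e.eval s + f.eval s
  | sub e f => e.eval s - f.eval s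
  | mul e f => e.eval s * f.eval s
  | lt e f => if e.eval s < f.eval s then 1 else 0

/-- The cost of evaluating an expression: one step for every node. -/
def cost : Expr → ℕ
  | const _ => 1
  | var _ => 1
  | read _ i => i.cost + 1
  | add e f => e.cost + f.cost + 1
  | sub e f => e.cost + f.cost + 1
  | mul e f => e.cost + f.cost + 1
  | lt e f => e.cost + f.cost + 1

/-- The value of the expression and all intermediate values, array indices included, are at
most `W`. -/
def Fits (W : ℕ) (s : State) : Expr → Prop
  | const k => k ≤ W
  | var x => s.var x ≤ W
  | read a i => i.Fits W s ∧ s.arr a (i.eval s) ≤ W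
  | add e f => e.Fits W s ∧ f.Fits W s ∧ e.eval s + f.eval s ≤ W
  | sub e f => e.Fits W s ∧ f.Fits W s
  | mul e f => e.Fits W s ∧ f.Fits W s ∧ e.eval s * f.eval s ≤ W
  | lt e f => e.Fits W s ∧ f.Fits W s ∧ 1 ≤ W

end Expr

/-- Programs. A test `e` succeeds when its value is not `0`. -/
inductive Prog where
  | skip
  | assign (x : ℕ) (e : Expr)
  | write (a : ℕ) (i e : Expr)
  | seq (p q : Prog)
  | cond (e : Expr) (p q : Prog)
  | loop (e : Expr) (p : Prog)

/-- `Run W p s t s'`: started in the memory `s`, the program `p` halts after exactly `t` steps in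
the memory `s'`, and every number that it handles on the way is at most `W`. -/
inductive Run (W : ℕ) : Prog → State → ℕ → State → Prop where
  | skip (s : State) : Run W Prog.skip s 1 s
  | assign (s : State) (x : ℕ) (e : Expr) : e.Fits W s →
      Run W (Prog.assign x e) s (e.cost + 1)
        { s with var := Function.update s.var x (e.eval s) }
  | write (s : State) (a : ℕ) (i e : Expr) : i.Fits W s → e.Fits W s →
      Run W (Prog.write a i e) s (i.cost + e.cost + 1)
        { s with arr := Function.update s.arr a
                  (Function.update (s.arr a) (i.eval s) (e.eval s)) }
  | seq {s s' s'' : State} {t t' : ℕ} {p q : Prog} : Run W p s t s' → Run W q s' t' s'' →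
      Run W (Prog.seq p q) s (t + t') s''
  | cond_true {s s' : State} {t : ℕ} {e : Expr} {p q : Prog} : e.Fits W s → e.eval s ≠ 0 →
      Run W p s t s' → Run W (Prog.cond e p q) s (e.cost + 1 + t) s'
  | cond_false {s s' : State} {t : ℕ} {e : Expr} {p q : Prog} : e.Fits W s → e.eval s = 0 →
      Run W q s t s' → Run W (Prog.cond e p q) s (e.cost + 1 + t) s'
  | loop_true {s s' s'' : State} {t t' : ℕ} {e : Expr} {p : Prog} : e.Fits W s →
      e.eval s ≠ 0 → Run W p s t s' → Run W (Prog.loop e p) s' t' s'' →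
      Run W (Prog.loop e p) s (e.cost + 1 + t + t') s''
  | loop_false {s : State} {e : Expr} {p : Prog} : e.Fits W s → e.eval s = 0 →
      Run W (Prog.loop e p) s (e.cost + 1) s

open Classical in
/-- The initial memory for the graph `G` with vertices `0, …, n - 1`: the variable `0` holds `n`,
the array `0` holds the adjacency matrix of `G`, row by row, and everything else is `0`. -/
noncomputable def input {n : ℕ} (G : SimpleGraph (Fin n)) : State where
  var x := if x = 0 then n else 0
  arr a m := if a = 0 ∧ ∃ i j : Fin n, m = (i : ℕ) * n + (j : ℕ) ∧ G.Adj i j then 1 else 0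

end RAM

/-! ### Expansion of independent sets in tensor powers -/

section Expansion

open Finset Classical

variable {V W : Type*} [Fintype V] [Fintype W]

/-! The capacity is determined by a(G): it is 1 if a(G) > 1/2 and a(G) otherwise. Let I be an
optimal independent set, q = |I| and p = |N(I)|. Letting the first coordinate in I ∪ N(I) decide
gives independent sets of G^k whose density tends to q/(p+q). If p < q, a majority vote does better:
the tuples with more coordinates in I than in N(I) are independent, and an exponential moment bound
shows that almost all tuples are of this kind. If q ≤ p, optimality says p|J| ≤ q|N(J)| for every
independent J; this expansion passes to tensor products (`Expands.prod`, a double count over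
fibres), so no independent set of G^k, k ≥ 1, has density above q/(p+q).

It remains to compute a(G). The complement of a permutation graph has a transitive orientation, and
the independent sets are the chains of this order. A vertex adjacent to two elements of a chain is
adjacent to all elements between them (`IsCoOrder.adj_between`), so putting v on top of a chain with
top u enlarges the neighbourhood by exactly N(v) \ N(u). Hence a dynamic program indexed by size and
top element finds the smallest neighbourhoods: n² entries, each a maximum over n predecessors.

The order has to be found from the adjacency matrix alone. Orienting one non-adjacent pair forces
others; a queue explores these implication classes, handling each of at most n² pairs once in O(n)
steps. New classes are seeded in lexicographic order, and the triangle lemma shows that the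
resulting choices fit together to a transitive orientation (`IsLexOrientation.isCoOrder`). The
programs are verified with the judgement `Ends`, which carries the time bound and the word bound
along with the postcondition. -/

/-- The set of elements that are related to an element of `S`. -/
noncomputable def relNbhd (r : V → V → Prop) (S : Finset V) : Finset V :=
  univ.filter fun v => ∃ u ∈ S, r u v

theorem mem_relNbhd {r : V → V → Prop} {S : Finset V} {v : V} :
    v ∈ relNbhd r S ↔ ∃ u ∈ S, r u v := by
  simp [relNbhd]

/-- `S` has no related pair of elements. -/
def RelIndep (r : V → V → Prop) (S : Finset V) : Prop := ∀ x ∈ S, ∀ y ∈ S, ¬ r x y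

/-- Every independent set `I` satisfies `p * |I| ≤ q * |N(I)|`. -/
def Expands (r : V → V → Prop) (p q : ℕ) : Prop :=
  ∀ I : Finset V, RelIndep r I → p * #I ≤ q * #(relNbhd r I)

/-- The tensor product of two relations. -/
def relProd (r : V → V → Prop) (s : W → W → Prop) : V × W → V × W → Prop :=
  fun x y => r x.1 y.1 ∧ s x.2 y.2

/-- Let I consist of the isolated points of S. Then N(S) contains the disjoint sets N(I) and S \ I,
since a non-isolated point of S is a neighbour of a point of S. The hypothesis applies to I, and as
q ≤ p, shrinking I to J only weakens the bound. This makes expansion usable for sets that are not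
independent. -/
theorem Expands.le_of_isolated {r : V → V → Prop} (hr : ∀ x y, r x y → r y x) {p q : ℕ}
    (h : Expands r p q) (hpq : q ≤ p) {S J : Finset V} (hJ : J ⊆ S)
    (iso : ∀ x ∈ J, ∀ y ∈ S, ¬ r x y) :
    p * #J + q * #(S \ J) ≤ q * #(relNbhd r S) := by
  set I := S.filter fun x => ∀ y ∈ S, ¬ r x y with hI
  have hIS : I ⊆ S := filter_subset _ _
  have hJI : J ⊆ I := fun x hx => mem_filter.2 ⟨hJ hx, iso x hx⟩
  have h1 : #(relNbhd r I ∪ (S \ I)) ≤ #(relNbhd r S) := by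
    apply card_le_card
    intro v hv
    rcases Finset.mem_union.1 hv with hv | hv
    · obtain ⟨u, hu, huv⟩ := mem_relNbhd.1 hv
      exact mem_relNbhd.2 ⟨u, hIS hu, huv⟩
    · obtain ⟨hvS, hvI⟩ := Finset.mem_sdiff.1 hv
      have : ¬ ∀ y ∈ S, ¬ r v y := fun H => hvI (mem_filter.2 ⟨hvS, H⟩)
      push Not at this
      obtain ⟨y, hy, hvy⟩ := this
      exact mem_relNbhd.2 ⟨y, hy, hr _ _ hvy⟩
  have hd : Disjoint (relNbhd r I) (S \ I) := by
    rw [Finset.disjoint_left]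
    intro v hv hv'
    obtain ⟨u, hu, huv⟩ := mem_relNbhd.1 hv
    exact (mem_filter.1 hu).2 v (Finset.mem_sdiff.1 hv').1 huv
  rw [card_union_of_disjoint hd] at h1
  have h2 := h I fun x hx y hy => (mem_filter.1 hx).2 y (hIS hy)
  have h3 := card_sdiff_add_card_eq_card hJ
  have h4 := card_sdiff_add_card_eq_card hIS
  obtain ⟨d, hd⟩ := Nat.exists_eq_add_of_le (card_le_card hJI)
  have h5 : #(S \ J) = #(S \ I) + d := by omega
  have h6 := Nat.mul_le_mul_left q h1
  rw [hd] at h2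
  rw [h5]
  have h7 := Nat.mul_le_mul_right d hpq
  nlinarith

theorem card_filter_prod_eq_sum (P : V × W → Prop) [DecidablePred P]
    [∀ x, DecidablePred fun y => P (x, y)] :
    #(univ.filter P) = ∑ x, #(univ.filter fun y => P (x, y)) := by
  simp only [card_filter, Fintype.sum_prod_type]

theorem card_filter_prod_eq_sum_right (P : V × W → Prop) [DecidablePred P]
    [∀ y, DecidablePred fun x => P (x, y)] :
    #(univ.filter P) = ∑ y, #(univ.filter fun x => P (x, y)) := by
  simp only [card_filter, Fintype.sum_prod_type_right]

/-- A point of U is isolated in its fibre over V (`D`) or not (`C`). Let M be the number of pairs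
(x, y) with y in N(S x). Expansion in W, fibre by fibre, gives p|D| + q|C| ≤ qM. Expansion in V,
applied to the columns `T y`, gives p|C| + q(M - |C|) ≤ q|N(U)|. On adding the two, q|C| and qM
cancel. -/
theorem Expands.prod {r : V → V → Prop} {s : W → W → Prop} (hr : ∀ x y, r x y → r y x)
    (hs : ∀ x y, s x y → s y x) {p q : ℕ} (h : Expands r p q) (h' : Expands s p q)
    (hpq : q ≤ p) : Expands (relProd r s) p q := by
  intro U hU
  let S : V → Finset W := fun x => univ.filter fun y => (x, y) ∈ U
  let C : V × W → Prop := fun z => z ∈ U ∧ ∃ y' ∈ S z.1, s z.2 y'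
  let D : V × W → Prop := fun z => z ∈ U ∧ ∀ y' ∈ S z.1, ¬ s z.2 y'
  let T : W → Finset V := fun y => univ.filter fun x => y ∈ relNbhd s (S x)
  let K : W → Finset V := fun y => univ.filter fun x => C (x, y)
  have mS : ∀ x y, y ∈ S x ↔ (x, y) ∈ U := by simp [S]
  have e1 : ∀ x, S x \ (univ.filter fun y => D (x, y)) = univ.filter fun y => C (x, y) := by
    intro x
    ext y
    simp only [Finset.mem_sdiff, mS, mem_filter, mem_univ, true_and, C, D]
    constructor
    · rintro ⟨h1, h2⟩
      refine ⟨h1, ?_⟩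
      by_contra h3
      push Not at h3
      exact h2 ⟨h1, h3⟩
    · rintro ⟨h1, y', h2, h3⟩
      exact ⟨h1, fun h4 => h4.2 y' h2 h3⟩
  have hx : ∀ x, p * #(univ.filter fun y => D (x, y)) + q * #(univ.filter fun y => C (x, y)) ≤
      q * #(relNbhd s (S x)) := by
    intro x
    rw [← e1]
    refine h'.le_of_isolated hs hpq ?_ ?_
    · intro y hy
      simp only [mem_filter, mem_univ, true_and, D] at hy
      exact (mS _ _).2 hy.1
    · intro y hy
      simp only [mem_filter, mem_univ, true_and, D] at hy
      exact hy.2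
  have hKT : ∀ y, K y ⊆ T y := by
    intro y x hx
    simp only [K, T, mem_filter, mem_univ, true_and, C] at hx ⊢
    obtain ⟨-, y', hy', hyy⟩ := hx
    exact mem_relNbhd.2 ⟨y', hy', hs _ _ hyy⟩
  have hy : ∀ y, p * #(K y) + q * #(T y \ K y) ≤ q * #(relNbhd r (T y)) := by
    intro y
    refine h.le_of_isolated hr hpq (hKT y) ?_
    -- If x were related to x2, then (x, y) and (x2, y2), with y2 a neighbour of y in the fibre over
    -- x2, would be a related pair in U.
    intro x hx x2 hx2 hxx
    simp only [K, T, mem_filter, mem_univ, true_and, C] at hx hx2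
    obtain ⟨y2, hy2, hyy⟩ := mem_relNbhd.1 hx2
    exact hU _ hx.1 _ ((mS _ _).1 hy2) ⟨hxx, hs _ _ hyy⟩
  have hNU : ∀ y, #(relNbhd r (T y)) ≤
      #(univ.filter fun x => (x, y) ∈ relNbhd (relProd r s) U) := by
    intro y
    apply card_le_card
    intro x hx
    obtain ⟨x1, hx1, hxx⟩ := mem_relNbhd.1 hx
    simp only [T, mem_filter, mem_univ, true_and] at hx1 ⊢
    obtain ⟨y1, hy1, hyy⟩ := mem_relNbhd.1 hx1
    exact mem_relNbhd.2 ⟨(x1, y1), (mS _ _).1 hy1, hxx, hyy⟩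
  have c1 : #U = #(univ.filter D) + #(univ.filter C) := by
    rw [← card_union_of_disjoint]
    · congr 1
      ext z
      simp only [Finset.mem_union, mem_filter, mem_univ, true_and, C, D]
      constructor
      · intro hz
        by_cases H : ∀ y' ∈ S z.1, ¬ s z.2 y'
        · exact Or.inl ⟨hz, H⟩
        · push Not at H
          exact Or.inr ⟨hz, H⟩
      · rintro (h | h) <;> exact h.1
    · rw [Finset.disjoint_left]
      intro z hz hz'
      simp only [mem_filter, mem_univ, true_and, C, D] at hz hz'
      obtain ⟨-, y', h1, h2⟩ := hz'
      exact hz.2 y' h1 h2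
  have c2 : #(relNbhd (relProd r s) U) =
      ∑ y, #(univ.filter fun x => (x, y) ∈ relNbhd (relProd r s) U) := by
    have : #(univ.filter fun z : V × W => z ∈ relNbhd (relProd r s) U) =
        ∑ y, #(univ.filter fun x => (x, y) ∈ relNbhd (relProd r s) U) :=
      card_filter_prod_eq_sum_right fun z => z ∈ relNbhd (relProd r s) U
    rw [← this]
    congr 1
    ext z
    simp
  have c3 : ∑ y, #(T y) = ∑ x, #(relNbhd s (S x)) := by
    have h1 : #(univ.filter fun z : V × W => z.2 ∈ relNbhd s (S z.1)) = ∑ y, #(T y) :=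
      card_filter_prod_eq_sum_right fun z : V × W => z.2 ∈ relNbhd s (S z.1)
    have h2 : #(univ.filter fun z : V × W => z.2 ∈ relNbhd s (S z.1)) =
        ∑ x, #(univ.filter fun y => y ∈ relNbhd s (S x)) :=
      card_filter_prod_eq_sum fun z : V × W => z.2 ∈ relNbhd s (S z.1)
    rw [← h1, h2]
    exact sum_congr rfl fun x _ => by congr 1; ext y; simp
  have c4 : ∑ y, #(K y) = #(univ.filter C) := (card_filter_prod_eq_sum_right C).symm
  have d1 : #(univ.filter C) = ∑ x, #(univ.filter fun y => C (x, y)) :=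
    card_filter_prod_eq_sum C
  have d2 : #(univ.filter D) = ∑ x, #(univ.filter fun y => D (x, y)) :=
    card_filter_prod_eq_sum D
  have c5 : ∑ y, #(T y \ K y) + ∑ y, #(K y) = ∑ y, #(T y) := by
    rw [← sum_add_distrib]
    exact sum_congr rfl fun y _ => card_sdiff_add_card_eq_card (hKT y)
  have s1 := sum_le_sum fun x (_ : x ∈ univ) => hx x
  have s2 := sum_le_sum fun y (_ : y ∈ univ) =>
    (hy y).trans (Nat.mul_le_mul_left q (hNU y))
  simp only [sum_add_distrib, ← mul_sum] at s1 s2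
  rw [← d1, ← d2, ← c3, ← c5] at s1
  rw [← c2, c4] at s2
  rw [c4] at s1
  rw [c1]
  nlinarith

theorem Expands.of_equiv {r : V → V → Prop} {s : W → W → Prop} (e : V ≃ W)
    (he : ∀ x y, r x y ↔ s (e x) (e y)) {p q : ℕ} (h : Expands s p q) : Expands r p q := by
  intro I hI
  have h1 := h (I.map e.toEmbedding) (by
    intro x hx y hy
    obtain ⟨a, ha, rfl⟩ := Finset.mem_map.1 hx
    obtain ⟨b, hb, rfl⟩ := Finset.mem_map.1 hy
    exact fun hab => hI a ha b hb ((he a b).2 hab))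
  have h2 : relNbhd s (I.map e.toEmbedding) = (relNbhd r I).map e.toEmbedding := by
    ext w
    simp only [mem_relNbhd, Finset.mem_map, Equiv.coe_toEmbedding, exists_exists_and_eq_and]
    constructor
    · rintro ⟨u, hu, huw⟩
      exact ⟨e.symm w, ⟨u, hu, (he _ _).2 (by simpa using huw)⟩, by simp⟩
    · rintro ⟨v, ⟨u, hu, huv⟩, rfl⟩
      exact ⟨u, hu, (he _ _).1 huv⟩
  rwa [h2, card_map, card_map] at h1

/-- The tensor power of a relation. -/
def relPow (r : V → V → Prop) (k : ℕ) : (Fin k → V) → (Fin k → V) → Prop :=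
  fun x y => ∀ i, r (x i) (y i)

theorem Expands.pow {r : V → V → Prop} (hr : ∀ x y, r x y → r y x) {p q : ℕ}
    (h : Expands r p q) (hpq : q ≤ p) (k : ℕ) : Expands (relPow r k) p q := by
  induction k with
  | zero =>
    intro I hI
    -- The empty conjunction relates the only 0-tuple to itself, so no nonempty set is independent.
    have : I = ∅ := by
      by_contra hne
      obtain ⟨x, hx⟩ := nonempty_iff_ne_empty.2 hne
      exact hI x hx x hx fun i => i.elim0
    simp [this]
  | succ k ih =>
    refine Expands.of_equiv (Fin.consEquiv fun _ => V).symm ?_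
      (h.prod hr (fun x y hxy i => hr _ _ (hxy i)) ih hpq)
    intro x y
    simp only [relPow, relProd, Fin.consEquiv, Equiv.coe_fn_symm_mk]
    exact Fin.forall_fin_succ

/-- I and N(I) are disjoint, so |I| + |N(I)| is at most the number of vertices. This turns expansion
into a density bound. -/
theorem Expands.card_le {r : V → V → Prop} {p q : ℕ} (h : Expands r p q) {I : Finset V}
    (hI : RelIndep r I) : (p + q) * #I ≤ q * Fintype.card V := by
  have h1 := h I hI
  have hd : Disjoint I (relNbhd r I) := by
    rw [Finset.disjoint_left]
    intro v hv hv'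
    obtain ⟨u, hu, huv⟩ := mem_relNbhd.1 hv'
    exact hI u hu v hv huv
  have h2 := card_le_univ (I ∪ relNbhd r I)
  rw [card_union_of_disjoint hd] at h2
  have := Nat.mul_le_mul_left q h2
  nlinarith

/-- Tuples whose first coordinate in `I ∪ N(I)` lies in `I` form a large independent set. -/
theorem exists_relIndep_pow {r : V → V → Prop} (hr : ∀ x y, r x y → r y x) {I : Finset V}
    (hI : RelIndep r I) (k : ℕ) : ∃ S : Finset (Fin k → V), RelIndep (relPow r k) S ∧
      ((#I : ℝ) + #(relNbhd r I)) * #S =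
        #I * ((Fintype.card V : ℝ) ^ k - ((Fintype.card V : ℝ) - (#I + #(relNbhd r I))) ^ k) := by
  have hd : Disjoint I (relNbhd r I) := by
    rw [Finset.disjoint_left]
    intro v hv hv'
    obtain ⟨u, hu, huv⟩ := mem_relNbhd.1 hv'
    exact hI u hu v hv huv
  induction k with
  | zero => exact ⟨∅, by simp [RelIndep], by simp⟩
  | succ k ih =>
    obtain ⟨S, hS, hc⟩ := ih
    have hd2 : Disjoint (I ×ˢ (univ : Finset (Fin k → V))) ((I ∪ relNbhd r I)ᶜ ×ˢ S) := by
      rw [Finset.disjoint_left]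
      intro z hz hz'
      simp only [mem_product, Finset.mem_compl, Finset.mem_union] at hz hz'
      exact hz'.1 (Or.inl hz.1)
    refine ⟨(disjUnion _ _ hd2).map (Fin.consEquiv fun _ => V).toEmbedding, ?_, ?_⟩
    · intro x hx y hy hxy
      simp only [Finset.mem_map, Finset.mem_disjUnion, mem_product, Finset.mem_compl, Finset.mem_union, mem_univ, and_true,
        Equiv.coe_toEmbedding, Prod.exists] at hx hy
      obtain ⟨a, x, hx, rfl⟩ := hx
      obtain ⟨b, y, hy, rfl⟩ := hy
      have h0 : r a b := by simpa [Fin.consEquiv] using hxy 0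
      have h1 : relPow r k x y := fun i => by simpa [Fin.consEquiv] using hxy i.succ
      rcases hx with hx | ⟨hx, hx'⟩ <;> rcases hy with hy | ⟨hy, hy'⟩
      · exact hI a hx b hy h0
      · exact hy (Or.inr (mem_relNbhd.2 ⟨a, hx, h0⟩))
      · exact hx (Or.inr (mem_relNbhd.2 ⟨b, hy, hr _ _ h0⟩))
      · exact hS x hx' y hy' h1
    · have h1 : #((I ∪ relNbhd r I)ᶜ) + (#I + #(relNbhd r I)) = Fintype.card V := by
        rw [← card_union_of_disjoint hd, card_compl_add_card]
      have h2 : (#((I ∪ relNbhd r I)ᶜ) : ℝ) = (Fintype.card V : ℝ) - (#I + #(relNbhd r I)) := by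
        rw [← h1]; push_cast; ring
      rw [card_map, card_disjUnion, card_product, card_product]
      push_cast
      rw [h2]
      simp only [card_univ, Fintype.card_pi, prod_const, Fintype.card_fin]
      push_cast
      rw [pow_succ, pow_succ]
      linear_combination ((Fintype.card V : ℝ) - (#I + #(relNbhd r I))) * hc

/-- If `|N(I)| < |I|`, then the tuples with more coordinates in `I` than in `N(I)` form an
independent set, and few tuples do not belong to it. -/
theorem exists_relIndep_pow_of_lt {r : V → V → Prop} (hr : ∀ x y, r x y → r y x) {I : Finset V}
    (hI : RelIndep r I) (hlt : #(relNbhd r I) < #I) : ∃ c : ℝ, 0 ≤ c ∧ c < Fintype.card V ∧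
      ∀ k, ∃ S : Finset (Fin k → V), RelIndep (relPow r k) S ∧
        (Fintype.card V : ℝ) ^ k - c ^ k ≤ #S := by
  have hd : Disjoint I (relNbhd r I) := by
    rw [Finset.disjoint_left]
    intro v hv hv'
    obtain ⟨u, hu, huv⟩ := mem_relNbhd.1 hv'
    exact hI u hu v hv huv
  set N := relNbhd r I with hN
  have hlt' : (#N : ℝ) < #I := by exact_mod_cast hlt
  have hN0 : (0 : ℝ) ≤ #N := by positivity
  have hI0 : (0 : ℝ) < #I := by linarith
  -- The midpoint of |N|/|I| and 1. With weight l on I and 1/l on N, the total weight differs from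
  -- |V| by (1 - l)(|N|/l - |I|), which is negative for every l strictly between these two numbers.
  -- Unlike the minimiser √(|N|/|I|), the midpoint is positive even when N is empty.
  set l : ℝ := (#N + #I) / (2 * #I) with hl
  have l0 : 0 < l := by positivity
  have l1 : l ≤ 1 := by
    rw [hl, div_le_one (by positivity)]; linarith
  let w : V → ℝ := fun v => (if v ∈ I then l else 1) * (if v ∈ N then l⁻¹ else 1)
  have w0 : ∀ v, 0 ≤ w v := fun v => by
    simp only [w]; split_ifs <;> positivity
  have hw : ∀ v, w v = 1 + ((if v ∈ I then l - 1 else 0) + (if v ∈ N then l⁻¹ - 1 else 0)) := by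
    intro v
    by_cases h1 : v ∈ I <;> by_cases h2 : v ∈ N
    · exact absurd h2 (Finset.disjoint_left.1 hd h1)
    all_goals simp [w, h1, h2]
  have hsum : ∑ v, w v = Fintype.card V + (#I * (l - 1) + #N * (l⁻¹ - 1)) := by
    simp only [hw, sum_add_distrib, sum_ite_mem, univ_inter, sum_const, nsmul_eq_mul]
    simp
  refine ⟨∑ v, w v, sum_nonneg fun v _ => w0 v, ?_, ?_⟩
  · rw [hsum]
    have : #I * (l - 1) + #N * (l⁻¹ - 1) = - ((#I - #N : ℝ) ^ 2 / (2 * (#N + #I))) := by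
      rw [hl]
      field_simp
      ring
    rw [this]
    have : (0 : ℝ) < #I - #N := by linarith
    have : (0 : ℝ) < (#I - #N : ℝ) ^ 2 / (2 * (#N + #I)) := by positivity
    linarith
  · intro k
    let S : Finset (Fin k → V) := univ.filter fun x =>
      #(univ.filter fun i => x i ∈ N) < #(univ.filter fun i => x i ∈ I)
    refine ⟨S, ?_, ?_⟩
    · intro x hx y hy hxy
      simp only [S, mem_filter, mem_univ, true_and] at hx hy
      have a1 : #(univ.filter fun i => x i ∈ I) ≤ #(univ.filter fun i => y i ∈ N) :=
        card_le_card fun i hi => by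
          simp only [mem_filter, mem_univ, true_and] at hi ⊢
          exact mem_relNbhd.2 ⟨_, hi, hxy i⟩
      have a2 : #(univ.filter fun i => y i ∈ I) ≤ #(univ.filter fun i => x i ∈ N) :=
        card_le_card fun i hi => by
          simp only [mem_filter, mem_univ, true_and] at hi ⊢
          exact mem_relNbhd.2 ⟨_, hi, hr _ _ (hxy i)⟩
      omega
    -- Exponential moment bound: the k-th power expands into one product of weights per tuple, and
    -- outside S this product is a nonpositive power of l, hence at least 1.
    · have b1 : (#Sᶜ : ℝ) ≤ (∑ v, w v) ^ k := by
        rw [Fintype.sum_pow, card_eq_sum_ones]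
        push_cast
        refine (sum_le_sum fun x hx => ?_).trans
          (sum_le_sum_of_subset_of_nonneg (subset_univ Sᶜ)
            fun x _ _ => prod_nonneg fun i _ => w0 _)
        simp only [S, Finset.mem_compl, mem_filter, mem_univ, true_and, not_lt] at hx
        simp only [w, prod_mul_distrib, prod_ite, prod_const, one_pow, mul_one]
        obtain ⟨d, hd⟩ := Nat.exists_eq_add_of_le hx
        rw [hd, inv_pow, ← div_eq_mul_inv, one_le_div (by positivity)]
        exact pow_le_pow_of_le_one l0.le l1 (Nat.le_add_right _ _)
      have b2 : (#Sᶜ : ℝ) + #S = (Fintype.card V : ℝ) ^ k := by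
        have := card_compl_add_card S
        rw [Fintype.card_fun, Fintype.card_fin] at this
        exact_mod_cast this
      linarith

end Expansion

/-! ### The tensor capacity in terms of an optimal independent set -/

namespace SimpleGraph

open Finset Classical

variable {V : Type*}

theorem isIndepSet_coe_iff_relIndep (G : SimpleGraph V) (I : Finset V) :
    G.IsIndepSet (I : Set V) ↔ RelIndep G.Adj I := by
  constructor
  · intro h x hx y hy hxy
    exact h hx hy hxy.ne hxy
  · intro h x hx y hy _ hxy
    exact h x hx y hy hxy

theorem coe_relNbhd [Fintype V] (G : SimpleGraph V) (I : Finset V) :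
    (relNbhd G.Adj I : Set V) = G.nbhd I := by
  ext v
  simp [nbhd, mem_relNbhd]

/-- A coordinate exists when k ≥ 1, so looplessness of G makes the clause x ≠ y redundant. For k = 0
the two relations differ; the limits ignore that term. -/
theorem tensorPower_adj_iff (G : SimpleGraph V) {k : ℕ} (hk : k ≠ 0) (x y : Fin k → V) :
    (G.tensorPower k).Adj x y ↔ relPow G.Adj k x y := by
  refine ⟨fun h => h.2, fun h => ⟨?_, h⟩⟩
  rintro rfl
  exact (h ⟨0, Nat.pos_of_ne_zero hk⟩).ne rfl

theorem relIndep_relPow_iff (G : SimpleGraph V) {k : ℕ} (hk : k ≠ 0) (S : Finset (Fin k → V)) :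
    (G.tensorPower k).IsIndepSet (S : Set (Fin k → V)) ↔ RelIndep (relPow G.Adj k) S := by
  rw [isIndepSet_coe_iff_relIndep]
  simp only [RelIndep, G.tensorPower_adj_iff hk]

variable [Fintype V]

theorem card_div_le_indepRatio_tensorPower (G : SimpleGraph V) {k : ℕ} (hk : k ≠ 0)
    {S : Finset (Fin k → V)} (hS : RelIndep (relPow G.Adj k) S) :
    (#S : ℝ) / (Fintype.card V : ℝ) ^ k ≤ (G.tensorPower k).indepRatio := by
  have h := ((G.relIndep_relPow_iff hk S).2 hS).card_le_indepNum
  rw [indepRatio, Nat.card_eq_fintype_card, Fintype.card_fun, Fintype.card_fin, Nat.cast_pow]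
  gcongr

theorem indepRatio_tensorPower_le (G : SimpleGraph V) {k : ℕ} (hk : k ≠ 0) {c : ℝ}
    (hc : ∀ S : Finset (Fin k → V), RelIndep (relPow G.Adj k) S →
      (#S : ℝ) / (Fintype.card V : ℝ) ^ k ≤ c) :
    (G.tensorPower k).indepRatio ≤ c := by
  obtain ⟨S, hS⟩ := (G.tensorPower k).exists_isNIndepSet_indepNum
  have := hc S ((G.relIndep_relPow_iff hk S).1 hS.1)
  rw [hS.2] at this
  rwa [indepRatio, Nat.card_eq_fintype_card, Fintype.card_fun, Fintype.card_fin, Nat.cast_pow]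

/-- If `|N(I)| < |I|` for an independent set `I`, then the tensor capacity is `1`. -/
theorem isTensorCapacity_one (G : SimpleGraph V) {I : Finset V} (hI : RelIndep G.Adj I)
    (hlt : #(relNbhd G.Adj I) < #I) : G.IsTensorCapacity 1 := by
  obtain ⟨c, hc0, hc, H⟩ := exists_relIndep_pow_of_lt (fun _ _ h => G.adj_symm h) hI hlt
  have hn : (0 : ℝ) < Fintype.card V := hc0.trans_lt hc
  refine tendsto_of_tendsto_of_tendsto_of_le_of_le'
    (g := fun k => 1 - (c / Fintype.card V) ^ k) (h := fun _ => 1) ?_ tendsto_const_nhds ?_ ?_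
  · have := tendsto_pow_atTop_nhds_zero_of_lt_one (r := c / Fintype.card V) (by positivity)
      ((div_lt_one hn).2 hc)
    simpa using this.const_sub 1
  · filter_upwards [eventually_ne_atTop 0] with k hk
    obtain ⟨S, hS, hcard⟩ := H k
    refine le_trans ?_ (G.card_div_le_indepRatio_tensorPower hk hS)
    rw [le_div_iff₀ (by positivity), div_pow]
    refine le_trans (le_of_eq ?_) hcard
    field_simp
  · filter_upwards [eventually_ne_atTop 0] with k hk
    refine G.indepRatio_tensorPower_le hk fun S _ => ?_
    rw [div_le_one (by positivity)]
    have := card_le_univ S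
    rw [Fintype.card_fun, Fintype.card_fin] at this
    exact_mod_cast this

/-- If `I` is an independent set that attains the maximum `a(G)` and `|I| ≤ |N(I)|`, then the
tensor capacity is `|I| / (|I| + |N(I)|)`. -/
theorem isTensorCapacity_of_le (G : SimpleGraph V) {I : Finset V} (hI : RelIndep G.Adj I)
    (hne : I.Nonempty) (hle : #I ≤ #(relNbhd G.Adj I))
    (hmax : Expands G.Adj #(relNbhd G.Adj I) #I) :
    G.IsTensorCapacity ((#I : ℝ) / (#I + #(relNbhd G.Adj I))) := by
  set p := #(relNbhd G.Adj I) with hp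
  have hq : 0 < #I := card_pos.2 hne
  have hq' : (0 : ℝ) < #I := by exact_mod_cast hq
  have hcard : #I + p ≤ Fintype.card V := by
    have hd : Disjoint I (relNbhd G.Adj I) := by
      rw [Finset.disjoint_left]
      intro v hv hv'
      obtain ⟨u, hu, huv⟩ := mem_relNbhd.1 hv'
      exact hI u hu v hv huv
    rw [hp, ← card_union_of_disjoint hd]
    exact card_le_univ _
  have hcard' : (#I : ℝ) + p ≤ Fintype.card V := by exact_mod_cast hcard
  have hn : (0 : ℝ) < Fintype.card V := by
    have : (0 : ℝ) ≤ p := by positivity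
    linarith
  set m : ℝ := #I + p with hm
  have hm0 : 0 < m := by positivity
  refine tendsto_of_tendsto_of_tendsto_of_le_of_le'
    (g := fun k => (#I : ℝ) / m * (1 - ((Fintype.card V - m) / Fintype.card V) ^ k))
    (h := fun _ => (#I : ℝ) / m) ?_ tendsto_const_nhds ?_ ?_
  · have := tendsto_pow_atTop_nhds_zero_of_lt_one (r := (Fintype.card V - m) / Fintype.card V)
      (div_nonneg (by linarith) hn.le) ((div_lt_one hn).2 (by linarith))
    simpa using (this.const_sub 1).const_mul ((#I : ℝ) / m)
  · filter_upwards [eventually_ne_atTop 0] with k hk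
    obtain ⟨S, hS, hc⟩ := exists_relIndep_pow (fun _ _ h => G.adj_symm h) hI k
    refine le_trans (le_of_eq ?_) (G.card_div_le_indepRatio_tensorPower hk hS)
    rw [← hp, ← hm] at hc
    rw [div_pow]
    field_simp
    linarith
  · filter_upwards [eventually_ne_atTop 0] with k hk
    refine G.indepRatio_tensorPower_le hk fun S hS => ?_
    have := (hmax.pow (fun _ _ h => G.adj_symm h) hle k).card_le hS
    rw [Fintype.card_fun, Fintype.card_fin] at this
    have h2 : ((p : ℝ) + #I) * #S ≤ #I * (Fintype.card V : ℝ) ^ k := by exact_mod_cast this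
    rw [div_le_div_iff₀ (by positivity) hm0, hm]
    linarith

/-- If every independent set expands at least as much as the independent set `I`, then `I`
attains the maximum `a(G)`. -/
theorem isMaxNbhdRatio_of_expands (G : SimpleGraph V) {I : Finset V} (hI : RelIndep G.Adj I)
    (hne : I.Nonempty) (hmax : Expands G.Adj #(relNbhd G.Adj I) #I) :
    G.IsMaxNbhdRatio ((#I : ℝ) / (#I + #(relNbhd G.Adj I))) := by
  constructor
  · refine ⟨I, by simpa using hne, (G.isIndepSet_coe_iff_relIndep I).2 hI, ?_⟩
    rw [← coe_relNbhd, Set.ncard_coe_finset, Set.ncard_coe_finset]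
  · rintro _ ⟨J, hJ, hJi, rfl⟩
    obtain ⟨J, rfl⟩ : ∃ J' : Finset V, J = J' := ⟨J.toFinset, by simp⟩
    rw [isIndepSet_coe_iff_relIndep] at hJi
    rw [← coe_relNbhd, Set.ncard_coe_finset, Set.ncard_coe_finset]
    have h := hmax J hJi
    have hq : (0 : ℝ) < #I := by exact_mod_cast card_pos.2 hne
    have hq2 : (0 : ℝ) < #J := by exact_mod_cast card_pos.2 (by simpa using hJ)
    have h' : (#(relNbhd G.Adj I) : ℝ) * #J ≤ #I * #(relNbhd G.Adj J) := by exact_mod_cast h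
    rw [div_le_div_iff₀ (by positivity) (by positivity)]
    nlinarith

end SimpleGraph

/-! ### Transitive orientations of the complement -/

namespace SimpleGraph

variable {V : Type*}

/-- A pair of different vertices that are not adjacent. -/
def NonEdge (G : SimpleGraph V) (p : V × V) : Prop := p.1 ≠ p.2 ∧ ¬ G.Adj p.1 p.2

/-- A strict partial order whose incomparability graph is `G`, given as a set of pairs. -/
structure IsCoOrder (G : SimpleGraph V) (D : V × V → Prop) : Prop where
  nonEdge : ∀ p, D p → G.NonEdge p
  total : ∀ p, G.NonEdge p → D p ∨ D p.swap
  asymm : ∀ p, D p → ¬ D p.swap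
  trans : ∀ a b c, D (a, b) → D (b, c) → D (a, c)

/-- The geometric order of the segments of a permutation diagram. -/
theorem IsPermutationGraph.exists_isCoOrder {G : SimpleGraph V} (h : G.IsPermutationGraph) :
    ∃ D, G.IsCoOrder D := by
  obtain ⟨t, b, ht, hb, h⟩ := h
  have key : ∀ u v, u ≠ v → t u < t v → (G.Adj u v ↔ ¬ b u < b v) := by
    intro u v huv htuv
    rw [h, and_iff_right huv]
    constructor
    · rintro ⟨⟨x, y⟩, h1, h2⟩ hlt
      rw [segment_eq_image] at h1 h2
      obtain ⟨l, ⟨l0, l1⟩, hl⟩ := h1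
      obtain ⟨m, ⟨m0, m1⟩, hm⟩ := h2
      simp only [Prod.smul_mk, smul_eq_mul, Prod.mk_add_mk, Prod.mk.injEq] at hl hm
      -- Equal heights mean equal parameters. The horizontal gap there is a convex combination of
      -- the two end gaps, both positive, so it cannot vanish.
      obtain rfl : l = m := by linarith [hl.2, hm.2]
      rcases le_total (t v - t u) (b v - b u) with hc | hc
      · nlinarith [hl.1, hm.1, mul_le_mul_of_nonneg_left hc l0]
      · nlinarith [hl.1, hm.1, mul_le_mul_of_nonneg_left hc (sub_nonneg.2 l1)]
    · intro hlt
      have hlt : b v < b u := lt_of_le_of_ne (not_lt.1 hlt) fun e => huv (hb e.symm)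
      have hs : 0 < (t v - t u) + (b u - b v) := by linarith
      -- The parameter at which the horizontal gap, positive at the top and negative at the bottom,
      -- becomes 0.
      set l := (t v - t u) / ((t v - t u) + (b u - b v)) with hl
      have l0 : 0 ≤ l := div_nonneg (by linarith) hs.le
      have l1 : l ≤ 1 := (div_le_one hs).2 (by linarith)
      have e : l * ((t v - t u) + (b u - b v)) = t v - t u := div_mul_cancel₀ _ hs.ne'
      refine ⟨((1 - l) * t u + l * b u, 1 - l), ?_, ?_⟩
      · rw [segment_eq_image]
        exact ⟨l, ⟨l0, l1⟩, by simp⟩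
      · rw [segment_eq_image]
        refine ⟨l, ⟨l0, l1⟩, ?_⟩
        simp only [Prod.smul_mk, smul_eq_mul, Prod.mk_add_mk, Prod.mk.injEq]
        constructor
        · linear_combination -e
        · ring
  refine ⟨fun p => t p.1 < t p.2 ∧ b p.1 < b p.2, ⟨?_, ?_, ?_, ?_⟩⟩
  · rintro ⟨u, v⟩ ⟨h1, h2⟩
    have huv : u ≠ v := fun e => by simp [e] at h1
    exact ⟨huv, fun ha => (key u v huv h1).1 ha h2⟩
  · rintro ⟨u, v⟩ ⟨huv, hadj⟩
    simp only at huv hadj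
    rcases lt_or_gt_of_ne fun e => huv (ht e) with h1 | h1
    · exact Or.inl ⟨h1, not_not.1 fun h2 => hadj ((key u v huv h1).2 h2)⟩
    · exact Or.inr ⟨h1, not_not.1 fun h2 => hadj ((key v u huv.symm h1).2 h2).symm⟩
  · rintro p h1 h2
    exact lt_asymm h1.1 h2.1
  · rintro x y z h1 h2
    exact ⟨h1.1.trans h2.1, h1.2.trans h2.2⟩

/-- In a transitive orientation of the complement, the orientation `p` forces the
orientation `q`. -/
inductive Force (G : SimpleGraph V) : V × V → V × V → Prop where
  | right {b c k : V} : G.Adj c k → ¬ G.Adj b k → Force G (b, c) (b, k)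
  | left {b c k : V} : G.Adj b k → ¬ G.Adj c k → Force G (b, c) (k, c)

/-- The reflexive transitive closure of `Force`; its classes are the implication classes. -/
def Reach (G : SimpleGraph V) : V × V → V × V → Prop := Relation.ReflTransGen G.Force

/-! ### Implication classes and lexicographic orientations -/

variable {G : SimpleGraph V} {p q r : V × V} {a b c : V}

theorem NonEdge.swap (h : G.NonEdge p) : G.NonEdge p.swap := ⟨h.1.symm, fun h' => h.2 h'.symm⟩

theorem Force.swap (h : G.Force p q) : G.Force p.swap q.swap := by
  cases h with
  | right h1 h2 => exact Force.left h1 h2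
  | left h1 h2 => exact Force.right h1 h2

theorem NonEdge.force (hp : G.NonEdge p) (h : G.Force p q) : G.NonEdge q := by
  cases h with
  | right h1 h2 => exact ⟨fun e => hp.2 (G.adj_symm (e ▸ h1)), h2⟩
  | left h1 h2 => exact ⟨fun e => hp.2 (e ▸ h1), fun h => h2 h.symm⟩

theorem Force.symm (hp : G.NonEdge p) (h : G.Force p q) : G.Force q p := by
  cases h with
  | right h1 h2 => exact Force.right h1.symm hp.2
  | left h1 h2 => exact Force.left h1.symm fun h => hp.2 h.symm

theorem Reach.swap (h : G.Reach p q) : G.Reach p.swap q.swap := by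
  induction h with
  | refl => exact Relation.ReflTransGen.refl
  | tail _ h2 ih => exact Relation.ReflTransGen.tail ih h2.swap

theorem NonEdge.reach (hp : G.NonEdge p) (h : G.Reach p q) : G.NonEdge q := by
  induction h with
  | refl => exact hp
  | tail _ h2 ih => exact ih.force h2

theorem Reach.symm (hp : G.NonEdge p) (h : G.Reach p q) : G.Reach q p := by
  induction h with
  | refl => exact Relation.ReflTransGen.refl
  | tail h1 h2 ih => exact Relation.ReflTransGen.head (h2.symm (hp.reach h1)) ih

theorem Reach.trans (h : G.Reach p q) (h' : G.Reach q r) : G.Reach p r :=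
  Relation.ReflTransGen.trans h h'

theorem Force.reach (h : G.Force p q) : G.Reach p q := Relation.ReflTransGen.single h

/-- If the forced pair had the opposite orientation, transitivity with `p` would orient the very
edge of G that causes the forcing. -/
theorem IsCoOrder.of_force {D : V × V → Prop} (hD : G.IsCoOrder D) (hp : D p)
    (h : G.Force p q) : D q := by
  have hq := (hD.nonEdge p hp).force h
  refine (hD.total q hq).resolve_right fun hq' => ?_
  cases h with
  | right h1 h2 => exact (hD.nonEdge _ (hD.trans _ _ _ hq' hp)).2 h1.symm
  | left h1 h2 => exact (hD.nonEdge _ (hD.trans _ _ _ hp hq')).2 h1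

theorem IsCoOrder.of_reach {D : V × V → Prop} (hD : G.IsCoOrder D) (hp : D p)
    (h : G.Reach p q) : D q := by
  induction h with
  | refl => exact hp
  | tail _ h2 ih => exact hD.of_force ih h2

/-- No implication class contains a pair in both orientations. -/
theorem IsCoOrder.not_reach_swap {D : V × V → Prop} (hD : G.IsCoOrder D) (hp : G.NonEdge p) :
    ¬ G.Reach p p.swap := by
  intro h
  rcases hD.total p hp with h1 | h1
  · exact hD.asymm _ h1 (hD.of_reach h1 h)
  · exact hD.asymm _ h1 (hD.of_reach h1 h.swap)

/-- The triangle lemma of Gallai and Golumbic. -/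
theorem Reach.triangle (hab : G.NonEdge (a, b)) (hac : G.NonEdge (a, c))
    (h1 : ¬ G.Reach (b, c) (b, a)) (h2 : ¬ G.Reach (b, c) (a, c)) (h : G.Reach (b, c) q) :
    G.NonEdge (a, q.1) ∧ G.NonEdge (a, q.2) ∧
      G.Reach (a, b) (a, q.1) ∧ G.Reach (a, c) (a, q.2) := by
  induction h with
  | refl => exact ⟨hab, hac, Relation.ReflTransGen.refl, Relation.ReflTransGen.refl⟩
  | tail h3 h4 ih =>
    obtain ⟨n1, n2, r1, r2⟩ := ih
    have h5 := Reach.trans h3 h4.reach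
    -- `g1` and `g2` exclude that the class of (b, c) meets a in a way that leads back to (b, a) or
    -- (a, c). Exactly this would happen if the new endpoint k below were equal or adjacent to a.
    have g1 : ∀ y, G.Reach (b, c) (y, a) → G.Reach (a, b) (a, y) → False := fun y k1 k2 =>
      h1 (k1.trans (k2.symm hab).swap)
    have g2 : ∀ y, G.Reach (b, c) (a, y) → G.Reach (a, c) (a, y) → False := fun y k1 k2 =>
      h2 (k1.trans (k2.symm hac))
    cases h4 with
    | @right b' c' k a1 a2 =>
      have na : a ≠ k := by
        rintro rfl
        exact g1 _ h5 r1
      have nk : ¬ G.Adj a k := fun hk =>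
        g1 b' (h5.trans (Force.right hk.symm fun h => n1.2 h.symm).reach) r1
      exact ⟨n1, ⟨na, nk⟩, r1, r2.trans (Force.right a1 nk).reach⟩
    | @left b' c' k a1 a2 =>
      have na : a ≠ k := by
        rintro rfl
        exact g2 _ h5 r2
      have nk : ¬ G.Adj a k := fun hk =>
        g2 c' (h5.trans (Force.left hk.symm fun h => n2.2 h.symm).reach) r2
      exact ⟨⟨na, nk⟩, n2, r1.trans (Force.right a1 nk).reach, r2⟩

/-- An orientation of the complement that is a union of implication classes, each of which is
oriented away from the smallest vertex that it touches. -/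
structure IsLexOrientation [LinearOrder V] (G : SimpleGraph V) (D : V × V → Prop) : Prop where
  nonEdge : ∀ p, D p → G.NonEdge p
  total : ∀ p, G.NonEdge p → D p ∨ D p.swap
  asymm : ∀ p, D p → ¬ D p.swap
  closed : ∀ p q, D p → G.Force p q → D q
  seed : ∀ p, D p → ∃ q, G.Reach q p ∧ D q ∧ ∀ r, G.Reach q r → q.1 ≤ r.1 ∧ q.1 ≤ r.2

/-- A lexicographic orientation of the complement is transitive (Hell and Huang). -/
theorem IsLexOrientation.isCoOrder [LinearOrder V] [WellFoundedLT V] {D : V × V → Prop}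
    (h : G.IsLexOrientation D) : G.IsCoOrder D := by
  have reach : ∀ p q, D p → G.Reach p q → D q := by
    intro p q hp hpq
    induction hpq with
    | refl => exact hp
    | tail _ h2 ih => exact h.closed _ _ ih h2
  have tri : ∀ a b c b' c', D (a, b) → D (b, c) → D (c, a) → G.Reach (b, c) (b', c') →
      D (a, b') ∧ D (b', c') ∧ D (c', a) := by
    intro a b c b' c' hab hbc hca hr
    obtain ⟨-, -, r1, r2⟩ := Reach.triangle (h.nonEdge _ hab)
      (h.nonEdge _ hca).swap (fun k => h.asymm _ hab (reach _ _ hbc k))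
      (fun k => h.asymm _ hca (reach _ _ hbc k)) hr
    exact ⟨reach _ _ hab r1, reach _ _ hbc hr, reach (c, a) (c', a) hca r2.swap⟩
  have acyc : ∀ a b c, D (a, b) → D (b, c) → ¬ D (c, a) := by
    intro a₀ b₀ c₀ h1 h2 h3
    -- Take a cyclic triangle through the smallest possible vertex a. The triangle lemma moves its
    -- side (c, a) to the seed (i, j) of that class, keeping b. Since i ≤ a, minimality gives i = a,
    -- and the side (b, i) now contradicts (a, b).
    obtain ⟨a, ⟨b, c, hab, hbc, hca⟩, hmin⟩ := wellFounded_lt.has_min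
      {a : V | ∃ b c, D (a, b) ∧ D (b, c) ∧ D (c, a)} ⟨a₀, b₀, c₀, h1, h2, h3⟩
    obtain ⟨⟨i, j⟩, hr, hD, hle⟩ := h.seed _ hca
    obtain ⟨k1, k2, k3⟩ := tri b c a i j hbc hca hab (hr.symm (h.nonEdge _ hD))
    have hi : i = a := le_antisymm (hle _ hr).2 (not_lt.1 (hmin i ⟨j, b, k2, k3, k1⟩))
    subst hi
    exact h.asymm _ hab k1
  refine ⟨h.nonEdge, h.total, h.asymm, fun a b c hab hbc => ?_⟩
  have hac : G.NonEdge (a, c) := by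
    constructor
    · rintro (rfl : a = c)
      exact h.asymm _ hab hbc
    · intro hadj
      exact h.asymm _ hbc (h.closed _ _ hab (Force.left hadj (h.nonEdge _ hbc).2))
  exact (h.total _ hac).resolve_right (acyc a b c hab hbc)

/-! ### Dynamic programming over chains -/

section Chains

open Finset Classical

/-- A non-neighbour k of v is comparable to v: above v it is also above u, below v it is also below
w, and neither is compatible with the edges. Thus, in a chain, a neighbour of the new top that is
already adjacent to some element is adjacent to the old top. -/
theorem IsCoOrder.adj_between {D : V × V → Prop} (hD : G.IsCoOrder D) {u v w k : V}
    (huv : D (u, v)) (hvw : D (v, w)) (hu : G.Adj u k) (hw : G.Adj w k) : G.Adj v k := by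
  by_contra hv
  have hne : v ≠ k := by
    rintro rfl
    exact (hD.nonEdge _ huv).2 hu
  rcases hD.total (v, k) ⟨hne, hv⟩ with h | h
  · exact (hD.nonEdge _ (hD.trans _ _ _ huv h)).2 hu
  · exact (hD.nonEdge _ (hD.trans _ _ _ h hvw)).2 hw.symm

/-- Non-adjacent vertices are comparable, so independent sets are chains. -/
theorem IsCoOrder.exists_top {D : V × V → Prop} (hD : G.IsCoOrder D) {I : Finset V}
    (hI : RelIndep G.Adj I) (hne : I.Nonempty) : ∃ v ∈ I, ∀ u ∈ I, u ≠ v → D (u, v) := by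
  induction I using Finset.induction_on with
  | empty => simp at hne
  | insert a I ha ih =>
    rcases I.eq_empty_or_nonempty with rfl | hne'
    · exact ⟨a, by simp⟩
    obtain ⟨v, hv, htop⟩ := ih
      (fun x hx y hy => hI x (mem_insert_of_mem hx) y (mem_insert_of_mem hy)) hne'
    have hav : a ≠ v := fun e => ha (e ▸ hv)
    rcases hD.total (a, v) ⟨hav, hI a (mem_insert_self _ _) v (mem_insert_of_mem hv)⟩ with h | h
    · refine ⟨v, mem_insert_of_mem hv, fun u hu huv => ?_⟩
      rcases mem_insert.1 hu with rfl | hu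
      · exact h
      · exact htop u hu huv
    · refine ⟨a, mem_insert_self _ _, fun u hu hua => ?_⟩
      have hu := (mem_insert.1 hu).resolve_left hua
      by_cases huv : u = v
      · exact huv ▸ h
      · exact hD.trans _ _ _ (htop u hu huv) h

variable [Fintype V]

/-- `chainGain G D s v` is `|V| + 1` minus the smallest size of the neighbourhood of a chain
of `D` with `s + 1` elements and the greatest element `v`; it is `0` if there is none. -/
noncomputable def chainGain (G : SimpleGraph V) (D : V × V → Prop) : ℕ → V → ℕ
  | 0, v => Fintype.card V + 1 - #(univ.filter fun k => G.Adj v k)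
  | s + 1, v => univ.sup fun u =>
      if D (u, v) then chainGain G D s u - #(univ.filter fun k => ¬ G.Adj u k ∧ G.Adj v k) else 0

/-- Follow the maximisers of the recursion backwards; a positive value has a positive predecessor,
so truncation does no harm. Only the inclusion N(I ∪ {v}) ⊆ N(I) ∪ (N(v) \ N(u)) is needed. -/
theorem exists_chain_of_chainGain_pos {D : V × V → Prop} (hD : G.IsCoOrder D) {s : ℕ} {v : V}
    (h : 0 < G.chainGain D s v) : ∃ I : Finset V, RelIndep G.Adj I ∧ #I = s + 1 ∧ v ∈ I ∧
      (∀ u ∈ I, u ≠ v → D (u, v)) ∧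
      #(relNbhd G.Adj I) + G.chainGain D s v ≤ Fintype.card V + 1 := by
  induction s generalizing v with
  | zero =>
    refine ⟨{v}, by simp [RelIndep], by simp, by simp, by simp, ?_⟩
    have : relNbhd G.Adj {v} = univ.filter fun k => G.Adj v k := by
      ext k; simp [mem_relNbhd]
    rw [this]
    simp only [chainGain] at h ⊢
    omega
  | succ s ih =>
    obtain ⟨u, -, hu⟩ := exists_mem_eq_sup univ ⟨v, mem_univ v⟩ (fun u =>
      if D (u, v) then G.chainGain D s u - #(univ.filter fun k => ¬ G.Adj u k ∧ G.Adj v k) else 0)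
    rw [chainGain, hu] at h
    rw [chainGain, hu]
    by_cases huv : D (u, v)
    swap
    · simp [huv] at h
    simp only [if_pos huv] at h ⊢
    obtain ⟨I, hI, hcard, huI, htop, hle⟩ := ih (v := u) (by omega)
    have hDv : ∀ x ∈ I, D (x, v) := by
      intro x hx
      by_cases hxu : x = u
      · exact hxu ▸ huv
      · exact hD.trans _ _ _ (htop x hx hxu) huv
    have hv : v ∉ I := fun hv => (hD.nonEdge _ (hDv v hv)).1 rfl
    refine ⟨insert v I, ?_, ?_, mem_insert_self _ _, ?_, ?_⟩
    · intro x hx y hy hxy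
      rcases mem_insert.1 hx with hx | hx <;> rcases mem_insert.1 hy with hy | hy
      · exact hxy.ne (hx.trans hy.symm)
      · exact (hD.nonEdge _ (hDv y hy)).2 (hx ▸ hxy).symm
      · exact (hD.nonEdge _ (hDv x hx)).2 (hy ▸ hxy)
      · exact hI x hx y hy hxy
    · rw [card_insert_of_notMem hv, hcard]
    · intro x hx hxv
      exact hDv x ((mem_insert.1 hx).resolve_left hxv)
    · have : #(relNbhd G.Adj (insert v I)) ≤
          #(relNbhd G.Adj I) + #(univ.filter fun k => ¬ G.Adj u k ∧ G.Adj v k) := by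
        refine le_trans (card_le_card ?_) (card_union_le _ _)
        intro k hk
        obtain ⟨x, hx, hxk⟩ := mem_relNbhd.1 hk
        rw [Finset.mem_union]
        by_cases huk : G.Adj u k
        · exact Or.inl (mem_relNbhd.2 ⟨u, huI, huk⟩)
        rcases mem_insert.1 hx with rfl | hx
        · exact Or.inr (by simp [huk, hxk])
        · exact Or.inl (mem_relNbhd.2 ⟨x, hx, hxk⟩)
      omega

/-- For this direction the increments must be disjoint from the earlier neighbourhood, which is
where `IsCoOrder.adj_between` enters. Since |N(I)| ≤ |V|, the summand 1 makes the gain positive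
whenever a chain exists. -/
theorem le_chainGain_add_card_nbhd {D : V × V → Prop} (hD : G.IsCoOrder D) {s : ℕ} {v : V}
    {I : Finset V} (hI : RelIndep G.Adj I) (hcard : #I = s + 1) (hv : v ∈ I)
    (htop : ∀ u ∈ I, u ≠ v → D (u, v)) :
    Fintype.card V + 1 ≤ G.chainGain D s v + #(relNbhd G.Adj I) := by
  induction s generalizing v I with
  | zero =>
    obtain ⟨x, rfl⟩ := card_eq_one.1 hcard
    obtain rfl : v = x := by simpa using hv
    have : relNbhd G.Adj {v} = univ.filter fun k => G.Adj v k := by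
      ext k; simp [mem_relNbhd]
    rw [this, chainGain]
    omega
  | succ s ih =>
    have hc : #(I.erase v) = s + 1 := by rw [card_erase_of_mem hv, hcard]; rfl
    have hI' : RelIndep G.Adj (I.erase v) := fun x hx y hy =>
      hI x (mem_of_mem_erase hx) y (mem_of_mem_erase hy)
    obtain ⟨u, hu, hutop⟩ := hD.exists_top hI' (card_pos.1 (by omega))
    have huv : D (u, v) := htop u (mem_of_mem_erase hu) (ne_of_mem_erase hu)
    have h1 := ih hI' hc hu hutop
    have h2 : #(relNbhd G.Adj (I.erase v)) +
        #(univ.filter fun k => ¬ G.Adj u k ∧ G.Adj v k) ≤ #(relNbhd G.Adj I) := by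
      rw [← card_union_of_disjoint]
      · apply card_le_card
        intro k hk
        rcases Finset.mem_union.1 hk with hk | hk
        · obtain ⟨x, hx, hxk⟩ := mem_relNbhd.1 hk
          exact mem_relNbhd.2 ⟨x, mem_of_mem_erase hx, hxk⟩
        · exact mem_relNbhd.2 ⟨v, hv, (mem_filter.1 hk).2.2⟩
      · rw [Finset.disjoint_left]
        intro k hk hk'
        obtain ⟨x, hx, hxk⟩ := mem_relNbhd.1 hk
        obtain ⟨-, h3, h4⟩ := mem_filter.1 hk'
        by_cases hxu : x = u
        · exact h3 (hxu ▸ hxk)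
        · exact h3 (hD.adj_between (hutop x hx hxu) huv hxk h4)
    have h3 : G.chainGain D s u - #(univ.filter fun k => ¬ G.Adj u k ∧ G.Adj v k) ≤
        G.chainGain D (s + 1) v := by
      rw [chainGain]
      refine le_trans ?_ (le_sup (f := fun u => if D (u, v) then G.chainGain D s u -
        #(univ.filter fun k => ¬ G.Adj u k ∧ G.Adj v k) else 0) (mem_univ u))
      simp only [if_pos huv]
      exact le_rfl
    omega

/-- The best fraction among those given by `chainGain` comes from an optimal independent set. -/
theorem exists_optimal_of_chainGain {D : V × V → Prop} (hD : G.IsCoOrder D) {p q s : ℕ} {v : V}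
    (hpos : 0 < G.chainGain D s v) (hp : p = s + 1)
    (hq : q = s + 1 + (Fintype.card V + 1 - G.chainGain D s v))
    (hmax : ∀ s' v', s' < Fintype.card V → 0 < G.chainGain D s' v' →
      (s' + 1) * q ≤ p * (s' + 1 + (Fintype.card V + 1 - G.chainGain D s' v'))) :
    ∃ I : Finset V, I.Nonempty ∧ RelIndep G.Adj I ∧ Expands G.Adj #(relNbhd G.Adj I) #I ∧
      p = #I ∧ q = #I + #(relNbhd G.Adj I) := by
  have H : ∀ J : Finset V, RelIndep G.Adj J → J.Nonempty →
      #J * q ≤ p * (#J + #(relNbhd G.Adj J)) := by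
    intro J hJ hne
    obtain ⟨w, hw, htop⟩ := hD.exists_top hJ hne
    obtain ⟨m, hm⟩ := Nat.exists_eq_succ_of_ne_zero (card_pos.2 hne).ne'
    have h1 := le_chainGain_add_card_nbhd hD hJ hm hw htop
    have h2 := card_le_univ J
    have h3 : #(relNbhd G.Adj J) < Fintype.card V := by
      obtain ⟨x, hx⟩ := hne
      refine card_lt_univ_of_notMem (x := x) fun hx' => ?_
      obtain ⟨u, hu, hux⟩ := mem_relNbhd.1 hx'
      exact hJ u hu x hx hux
    have h4 := hmax m w (by omega) (by omega)
    rw [hm]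
    exact h4.trans (Nat.mul_le_mul_left _ (by omega))
  -- The chain behind the best entry is only known to satisfy |N(I)| ≤ q - p; optimality applied to
  -- I itself gives the reverse inequality.
  obtain ⟨I, hI, hcard, hv, -, hle⟩ := exists_chain_of_chainGain_pos hD hpos
  have hpI : p = #I := by omega
  have hne : I.Nonempty := ⟨v, hv⟩
  have h1 := H I hI hne
  rw [← hpI] at h1
  have h2 : q ≤ p + #(relNbhd G.Adj I) := Nat.le_of_mul_le_mul_left h1 (by omega)
  have hqI : q = #I + #(relNbhd G.Adj I) := by omega
  refine ⟨I, hne, hI, fun J hJ => ?_, hpI, hqI⟩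
  rcases J.eq_empty_or_nonempty with rfl | hJne
  · simp
  have := H J hJ hJne
  rw [hqI, hpI] at this
  nlinarith

end Chains

end SimpleGraph

/-! ### Total correctness with time bounds for programs -/

namespace RAM

/-- The scalar variables that a program may change. -/
def Prog.vars : Prog → List ℕ
  | skip => []
  | assign x _ => [x]
  | write _ _ _ => []
  | seq p q => p.vars ++ q.vars
  | cond _ p q => p.vars ++ q.vars
  | loop _ p => p.vars

/-- The arrays that a program may change. -/
def Prog.arrs : Prog → List ℕ
  | skip => []
  | assign _ _ => []
  | write a _ _ => [a]
  | seq p q => p.arrs ++ q.arrs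
  | cond _ p q => p.arrs ++ q.arrs
  | loop _ p => p.arrs

/-- The states `s` and `s'` differ at most in the variables `xs` and the arrays `as`. -/
def Frame (xs as : List ℕ) (s s' : State) : Prop :=
  (∀ x, x ∉ xs → s'.var x = s.var x) ∧ ∀ a, a ∉ as → s'.arr a = s.arr a

theorem Frame.refl (xs as : List ℕ) (s : State) : Frame xs as s s :=
  ⟨fun _ _ => rfl, fun _ _ => rfl⟩

theorem Frame.trans {xs as : List ℕ} {s s' s'' : State} (h : Frame xs as s s')
    (h' : Frame xs as s' s'') : Frame xs as s s'' :=
  ⟨fun x hx => (h'.1 x hx).trans (h.1 x hx), fun a ha => (h'.2 a ha).trans (h.2 a ha)⟩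

theorem Frame.mono {xs as xs' as' : List ℕ} {s s' : State} (h : Frame xs as s s')
    (hx : xs ⊆ xs') (ha : as ⊆ as') : Frame xs' as' s s' :=
  ⟨fun x hx' => h.1 x fun h' => hx' (hx h'), fun a ha' => h.2 a fun h' => ha' (ha h')⟩

theorem Run.frame {W : ℕ} {P : Prog} {s s' : State} {t : ℕ} (h : Run W P s t s') :
    Frame P.vars P.arrs s s' := by
  induction h with
  | skip s => exact Frame.refl _ _ _
  | assign s x e _ =>
    exact ⟨fun y hy => Function.update_of_ne (by simpa [Prog.vars] using hy) _ _, fun _ _ => rfl⟩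
  | write s a i e _ _ =>
    exact ⟨fun _ _ => rfl, fun b hb => Function.update_of_ne (by simpa [Prog.arrs] using hb) _ _⟩
  | seq _ _ ih1 ih2 =>
    exact (ih1.mono (List.subset_append_left _ _) (List.subset_append_left _ _)).trans
      (ih2.mono (List.subset_append_right _ _) (List.subset_append_right _ _))
  | cond_true _ _ _ ih =>
    exact ih.mono (List.subset_append_left _ _) (List.subset_append_left _ _)
  | cond_false _ _ _ ih =>
    exact ih.mono (List.subset_append_right _ _) (List.subset_append_right _ _)
  | loop_true _ _ _ _ ih1 ih2 => exact ih1.trans ih2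
  | loop_false _ _ => exact Frame.refl _ _ _

/-- Started in `s`, the program `P` halts within `T` steps in a state that satisfies `Q`. -/
def Ends (W : ℕ) (P : Prog) (s : State) (T : ℕ) (Q : State → Prop) : Prop :=
  ∃ t s', Run W P s t s' ∧ t ≤ T ∧ Q s'

variable {W : ℕ} {P P' : Prog} {s : State} {T T' : ℕ} {Q Q' : State → Prop} {e i : Expr}

theorem Ends.mono (h : Ends W P s T Q) (hT : T ≤ T') (hQ : ∀ s', Q s' → Q' s') :
    Ends W P s T' Q' := by
  obtain ⟨t, s', h1, h2, h3⟩ := h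
  exact ⟨t, s', h1, h2.trans hT, hQ _ h3⟩

theorem Ends.frame (h : Ends W P s T Q) :
    Ends W P s T fun s' => Q s' ∧ Frame P.vars P.arrs s s' := by
  obtain ⟨t, s', h1, h2, h3⟩ := h
  exact ⟨t, s', h1, h2, h3, h1.frame⟩

theorem Ends.skip (h : Q s) : Ends W Prog.skip s 1 Q := ⟨1, s, Run.skip s, le_rfl, h⟩

theorem Ends.assign {x : ℕ} (he : e.Fits W s)
    (h : Q { s with var := Function.update s.var x (e.eval s) }) :
    Ends W (Prog.assign x e) s (e.cost + 1) Q :=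
  ⟨_, _, Run.assign s x e he, le_rfl, h⟩

theorem Ends.write {a : ℕ} (hi : i.Fits W s) (he : e.Fits W s)
    (h : Q { s with
      arr := Function.update s.arr a (Function.update (s.arr a) (i.eval s) (e.eval s)) }) :
    Ends W (Prog.write a i e) s (i.cost + e.cost + 1) Q :=
  ⟨_, _, Run.write s a i e hi he, le_rfl, h⟩

theorem Ends.seq (h : Ends W P s T fun s' => Ends W P' s' T' Q) :
    Ends W (Prog.seq P P') s (T + T') Q := by
  obtain ⟨t, s', h1, h2, t', s'', h3, h4, h5⟩ := h
  exact ⟨_, _, Run.seq h1 h3, Nat.add_le_add h2 h4, h5⟩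

theorem Ends.cond (he : e.Fits W s) (h1 : e.eval s ≠ 0 → Ends W P s T Q)
    (h2 : e.eval s = 0 → Ends W P' s T' Q) :
    Ends W (Prog.cond e P P') s (e.cost + 1 + max T T') Q := by
  by_cases h : e.eval s = 0
  · obtain ⟨t, s', a1, a2, a3⟩ := h2 h
    exact ⟨_, _, Run.cond_false he h a1,
      Nat.add_le_add_left (a2.trans (le_max_right _ _)) _, a3⟩
  · obtain ⟨t, s', a1, a2, a3⟩ := h1 h
    exact ⟨_, _, Run.cond_true he h a1, Nat.add_le_add_left (a2.trans (le_max_left _ _)) _, a3⟩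

/-- Strong induction on the variant `m`: every round pays for the test and the body, and the last,
failing test is paid once. -/
theorem Ends.loop (I : State → Prop) (m : State → ℕ) (he : ∀ s, I s → e.Fits W s)
    (step : ∀ s, I s → e.eval s ≠ 0 → Ends W P s T fun s' => I s' ∧ m s' < m s)
    (init : I s) :
    Ends W (Prog.loop e P) s (m s * (T + e.cost + 1) + e.cost + 1)
      fun s' => I s' ∧ e.eval s' = 0 := by
  induction hm : m s using Nat.strong_induction_on generalizing s with
  | _ k ih =>
    by_cases h : e.eval s = 0
    · exact ⟨_, _, Run.loop_false (he s init) h, by omega, init, h⟩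
    · obtain ⟨t, s', a1, a2, a3, a4⟩ := step s init h
      obtain ⟨t', s'', b1, b2, b3⟩ := ih (m s') (hm ▸ a4) a3 rfl
      refine ⟨_, _, Run.loop_true (he s init) h a1 b1, ?_, b3⟩
      have : (m s' + 1) * (T + e.cost + 1) ≤ k * (T + e.cost + 1) :=
        Nat.mul_le_mul_right _ (by omega)
      rw [add_mul] at this
      omega

/-- `for x = 0, …, n + c - 1 do P`, where `n` is the content of the variable `0`. -/
def forLoop (x c : ℕ) (P : Prog) : Prog :=
  Prog.seq (Prog.assign x (Expr.const 0))
    (Prog.loop (Expr.lt (Expr.var x) (Expr.add (Expr.var 0) (Expr.const c)))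
      (Prog.seq P (Prog.assign x (Expr.add (Expr.var x) (Expr.const 1)))))

/-- The frame handed to the body lets invariants mention only what changes. A round costs T for the
body, 4 for the increment and 6 for the test; the initial assignment and the final test account for
the 8. -/
theorem Ends.forLoop {x c n : ℕ} (I : ℕ → State → Prop) (hn : s.var 0 = n) (hx0 : x ≠ 0)
    (hx : x ∉ P.vars) (h0 : 0 ∉ P.vars) (hW : n + c + 1 ≤ W)
    (init : I 0 { s with var := Function.update s.var x 0 })
    (step : ∀ i < n + c, ∀ s', s'.var 0 = n → s'.var x = i →
      Frame (x :: P.vars) P.arrs s s' → I i s' → Ends W P s' T fun s'' =>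
        I (i + 1) { s'' with var := Function.update s''.var x (i + 1) }) :
    Ends W (RAM.forLoop x c P) s ((n + c) * (T + 10) + 8) fun s' =>
      I (n + c) s' ∧ Frame (x :: P.vars) P.arrs s s' := by
  have hL := Ends.loop (W := W) (P := Prog.seq P (Prog.assign x (Expr.add (Expr.var x)
      (Expr.const 1)))) (T := T + 4)
    (e := Expr.lt (Expr.var x) (Expr.add (Expr.var 0) (Expr.const c)))
    (s := { s with var := Function.update s.var x 0 })
    (fun s' => s'.var x ≤ n + c ∧ s'.var 0 = n ∧ Frame (x :: P.vars) P.arrs s s' ∧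
      I (s'.var x) s')
    (fun s' => n + c - s'.var x)
    (fun s' ⟨h1, h2, _, _⟩ => by
      simp only [Expr.Fits, Expr.eval, h2]
      omega)
    (fun s' ⟨h1, h2, h3, h4⟩ hlt => by
      have hlt : s'.var x < n + c := by
        by_contra hc
        simp [Expr.eval, h2, hc] at hlt
      refine Ends.seq ((step _ hlt s' h2 rfl h3 h4).frame.mono le_rfl fun s'' hs => ?_)
      obtain ⟨hI, hF⟩ := hs
      have e1 : s''.var x = s'.var x := hF.1 x hx
      have e2 : s''.var 0 = n := (hF.1 0 h0).trans h2
      refine Ends.assign ?_ ?_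
      · simp only [Expr.Fits, Expr.eval, e1]
        omega
      · simp only [Expr.eval, e1, Function.update_self, Function.update_of_ne hx0.symm, e2]
        refine ⟨⟨hlt, trivial, ?_, hI⟩, by omega⟩
        constructor
        · intro y hy
          rw [List.mem_cons, not_or] at hy
          simp only [Function.update_of_ne hy.1]
          exact (hF.1 y hy.2).trans (h3.1 y (by simp [hy]))
        · intro a ha
          exact (hF.2 a ha).trans (h3.2 a ha))
    (by
      simp only [Function.update_self, Function.update_of_ne hx0.symm]
      refine ⟨Nat.zero_le _, hn, ⟨fun y hy => ?_, fun _ _ => rfl⟩, init⟩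
      rw [List.mem_cons, not_or] at hy
      exact Function.update_of_ne hy.1 _ _)
  refine Ends.mono (Ends.seq (Ends.assign (by simp [Expr.Fits]) hL)) ?_ ?_
  · simp only [Expr.cost, Function.update_self]
    rw [show T + 4 + (1 + (1 + 1 + 1) + 1) + 1 = T + 10 by ring]
    simp only [Nat.sub_zero]
    omega
  · rintro s' ⟨⟨h1, h2, h3, h4⟩, h5⟩
    have : s'.var x = n + c := by
      by_contra hc
      have : s'.var x < n + c := by omega
      simp [Expr.eval, h2, this] at h5
    rw [this] at h4
    exact ⟨h4, h3⟩

/-- Only the columns are bounded, so tables may have an extra row n. -/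
theorem index_inj {n u v u' v' : ℕ} (hv : v < n) (hv' : v' < n)
    (h : u * n + v = u' * n + v') : u = u' ∧ v = v' := by
  have hn : 0 < n := by omega
  have h1 := congrArg (· / n) h
  have h2 := congrArg (· % n) h
  simp only [mul_comm u, mul_comm u', Nat.mul_add_div hn, Nat.mul_add_mod,
    Nat.div_eq_of_lt hv, Nat.div_eq_of_lt hv', Nat.mod_eq_of_lt hv, Nat.mod_eq_of_lt hv'] at h1 h2
  omega

/-- Two nested loops that fill the array `a`, seen as a table with rows of length `n`. -/
theorem Ends.table {x y a c n : ℕ} (F : ℕ → ℕ → ℕ) (hn : s.var 0 = n) (hx0 : x ≠ 0) (hy0 : y ≠ 0)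
    (hxy : x ≠ y) (hx : x ∉ P.vars) (hy : y ∉ P.vars) (h0 : 0 ∉ P.vars) (hW : n + c + 1 ≤ W)
    (step : ∀ u < n + c, ∀ v < n, ∀ s', s'.var 0 = n → s'.var x = u → s'.var y = v →
      Frame (x :: y :: P.vars) P.arrs s s' →
      (∀ u' < u, ∀ v' < n, s'.arr a (u' * n + v') = F u' v') →
      Ends W P s' T fun s'' => s''.arr a = Function.update (s'.arr a) (u * n + v) (F u v)) :
    Ends W (RAM.forLoop x c (RAM.forLoop y 0 P)) s ((n + c) * (n * (T + 10) + 18) + 8) fun s' =>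
      (∀ u < n + c, ∀ v < n, s'.arr a (u * n + v) = F u v) ∧
        Frame (x :: y :: P.vars) P.arrs s s' := by
  have ev : (RAM.forLoop y 0 P).vars = y :: (P.vars ++ [y]) := rfl
  have ea : (RAM.forLoop y 0 P).arrs = P.arrs ++ [] := rfl
  have sub1 : ∀ {xs ys : List ℕ}, xs ⊆ ys → x :: (y :: (xs ++ [y])) ⊆ x :: y :: ys := by
    intro xs ys h z hz
    simp only [List.mem_cons, List.mem_append, List.not_mem_nil, or_false] at hz ⊢
    rcases hz with h1 | h1 | h1 | h1
    · exact Or.inl h1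
    · exact Or.inr (Or.inl h1)
    · exact Or.inr (Or.inr (h h1))
    · exact Or.inr (Or.inl h1)
  refine Ends.mono (Ends.forLoop (T := n * (T + 10) + 8)
    (fun i s' => ∀ u < i, ∀ v < n, s'.arr a (u * n + v) = F u v) hn hx0 ?_ ?_ hW ?_ ?_) le_rfl ?_
  · simp [ev, hxy, hx]
  · simp [ev, hy0.symm, h0]
  · intro u hu
    omega
  · intro i hi s1 hs0 hsx hF hI
    have hF1 : Frame (x :: y :: P.vars) P.arrs s s1 :=
      hF.mono (sub1 (List.Subset.refl _)) (by rw [ea, List.append_nil]; exact List.Subset.refl _)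
    refine Ends.mono (Ends.forLoop (n := n) (c := 0) (T := T) (fun j s' =>
        (∀ u < i, ∀ v < n, s'.arr a (u * n + v) = F u v) ∧
          ∀ v < j, s'.arr a (i * n + v) = F i v) hs0 hy0 hy h0 (by omega) ⟨hI, by simp⟩ ?_)
      (by simp) ?_
    · intro j hj s2 h20 h2y hF2 hI2
      have hF' : Frame (x :: y :: P.vars) P.arrs s s2 :=
        hF1.trans (hF2.mono (List.subset_cons_self _ _) (List.Subset.refl _))
      have h2x : s2.var x = i := (hF2.1 x (by simp [hxy, hx])).trans hsx
      refine (step i hi j hj s2 h20 h2x h2y hF' hI2.1).mono le_rfl fun s3 h3 => ?_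
      simp only [h3]
      constructor
      · intro u hu v hv
        rw [Function.update_of_ne, hI2.1 u hu v hv]
        intro e
        have := (index_inj hv hj e).1
        omega
      · intro v hv
        by_cases hvj : v = j
        · rw [hvj, Function.update_self]
        · rw [Function.update_of_ne, hI2.2 v (by omega)]
          omega
    · rintro s2 ⟨⟨h1, h2⟩, -⟩ u hu v hv
      by_cases hui : u = i
      · exact hui ▸ h2 v hv
      · exact h1 u (by omega) v hv
  · rintro s' ⟨h1, h2⟩
    exact ⟨h1, h2.mono (sub1 (List.Subset.refl _))
      (by rw [ea, List.append_nil]; exact List.Subset.refl _)⟩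

end RAM

/-! ### The program for the lexicographic orientation -/

namespace SimpleGraph

variable {n : ℕ} {G : SimpleGraph (Fin n)} {L : List (Fin n × Fin n)}

/-- The invariant of the set of pairs that have been oriented so far. -/
structure PartialOrientation (G : SimpleGraph (Fin n)) (L : List (Fin n × Fin n)) : Prop where
  nonEdge : ∀ p ∈ L, G.NonEdge p
  anti : ∀ p ∈ L, ∀ q ∈ L, ¬ G.Reach p q.swap
  seed : ∀ p ∈ L, ∃ q ∈ L, G.Reach q p ∧ ∀ r, G.Reach q r → q.1 ≤ r.1 ∧ q.1 ≤ r.2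

theorem PartialOrientation.seed_and (h : G.PartialOrientation L) : ∀ p ∈ L, ∃ q,
    G.Reach q p ∧ q ∈ L ∧ ∀ r, G.Reach q r → q.1 ≤ r.1 ∧ q.1 ≤ r.2 := by
  intro p hp
  obtain ⟨q, h1, h2, h3⟩ := h.seed p hp
  exact ⟨q, h2, h1, h3⟩

/-- The new pair lies in the class of `p` and inherits its seed and its compatibility with the list.
That it does not conflict with itself follows from the mere existence of a transitive orientation,
which the program need not know. -/
theorem PartialOrientation.append_force (h : G.PartialOrientation L) {D : Fin n × Fin n → Prop}
    (hD : G.IsCoOrder D) {p q : Fin n × Fin n} (hp : p ∈ L) (hpq : G.Force p q) :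
    G.PartialOrientation (L ++ [q]) := by
  have hpn := h.nonEdge p hp
  have hqn := hpn.force hpq
  refine ⟨?_, ?_, ?_⟩
  · intro r hr
    rcases List.mem_append.1 hr with hr | hr
    · exact h.nonEdge r hr
    · exact List.mem_singleton.1 hr ▸ hqn
  · intro r hr r' hr' hrr
    simp only [List.mem_append, List.mem_singleton] at hr hr'
    rcases hr with hr | rfl <;> rcases hr' with hr' | rfl
    · exact h.anti r hr r' hr' hrr
    · exact h.anti r hr p hp (hrr.trans (hpq.symm hpn).swap.reach)
    · exact h.anti p hp r' hr' (hpq.reach.trans hrr)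
    · exact hD.not_reach_swap hqn hrr
  · intro r hr
    rcases List.mem_append.1 hr with hr | hr
    · obtain ⟨s, hs, h1, h2⟩ := h.seed r hr
      exact ⟨s, List.mem_append_left _ hs, h1, h2⟩
    · obtain rfl := List.mem_singleton.1 hr
      obtain ⟨s, hs, h1, h2⟩ := h.seed p hp
      exact ⟨s, List.mem_append_left _ hs, h1.trans hpq.reach, h2⟩

/-- A list closed under forcing is a union of classes. If the class of `p` touched a vertex below
`p.1`, the pair there would already be oriented one way or the other, and closure would put `p` or
`p.swap` into the list. So `p` can be its own seed. -/
theorem PartialOrientation.append_seed (h : G.PartialOrientation L) {D : Fin n × Fin n → Prop}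
    (hD : G.IsCoOrder D) (hcl : ∀ p ∈ L, ∀ q, G.Force p q → q ∈ L) {p : Fin n × Fin n}
    (hp : G.NonEdge p) (h1 : p ∉ L) (h2 : p.swap ∉ L)
    (hdone : ∀ q, G.NonEdge q → q.1 < p.1 → q ∈ L ∨ q.swap ∈ L) :
    G.PartialOrientation (L ++ [p]) := by
  have reach : ∀ q r, G.Reach q r → q ∈ L → r ∈ L := by
    intro q r hqr hq
    induction hqr with
    | refl => exact hq
    | tail _ h2 ih => exact hcl _ ih _ h2
  have low : ∀ r, G.Reach p r → p.1 ≤ r.1 := by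
    intro r hr
    by_contra hlt
    rcases hdone r (hp.reach hr) (not_le.1 hlt) with h' | h'
    · exact h1 (reach _ _ (hr.symm hp) h')
    · exact h2 (reach _ _ (hr.symm hp).swap h')
  refine ⟨?_, ?_, ?_⟩
  · intro r hr
    rcases List.mem_append.1 hr with hr | hr
    · exact h.nonEdge r hr
    · exact List.mem_singleton.1 hr ▸ hp
  · intro r hr r' hr' hrr
    simp only [List.mem_append, List.mem_singleton] at hr hr'
    rcases hr with hr | rfl <;> rcases hr' with hr' | rfl
    · exact h.anti r hr r' hr' hrr
    · exact h2 (reach _ _ hrr hr)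
    · exact h2 (reach _ _ (hrr.symm hp).swap hr')
    · exact hD.not_reach_swap hp hrr
  · intro r hr
    rcases List.mem_append.1 hr with hr | hr
    · obtain ⟨s, hs, h1, h2⟩ := h.seed r hr
      exact ⟨s, List.mem_append_left _ hs, h1, h2⟩
    · obtain rfl := List.mem_singleton.1 hr
      refine ⟨r, by simp, Relation.ReflTransGen.refl, fun r' hr' => ⟨low r' hr', ?_⟩⟩
      by_contra hlt
      rcases hdone r'.swap (hp.reach hr').swap (not_le.1 hlt) with h' | h'
      · exact h2 (reach _ _ (hr'.symm hp).swap h')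
      · exact h1 (reach _ _ (hr'.symm hp) h')

end SimpleGraph

/-! ### Correctness and running time of the orientation program -/

namespace RAM

open RAM.Expr RAM.Prog SimpleGraph Classical

theorem eval_lt_le (s : State) (e f : Expr) : (lt e f).eval s ≤ 1 := by
  rw [eval]
  split_ifs <;> simp

/-- The entry in row `u` and column `v` of the array `a`. -/
def cell (a : ℕ) (u v : Expr) : Expr := read a (add (mul u (var 0)) v)

/-- Orient the pair of the variables `x`, `y` and append it to the queue. -/
def push (x y : ℕ) : Prog :=
  cond (cell 1 (Expr.var x) (Expr.var y)) skip
    (seq (Prog.write 1 (add (mul (Expr.var x) (Expr.var 0)) (Expr.var y)) (const 1))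
      (seq (Prog.write 2 (Expr.var 8) (Expr.var x))
        (seq (Prog.write 3 (Expr.var 8) (Expr.var y))
          (assign 8 (add (Expr.var 8) (const 1))))))

/-- Push the pairs that are forced by the pair of the variables `9`, `10` and that involve the
vertex in the variable `11`. -/
def forceBody : Prog :=
  seq (cond (lt (cell 0 (Expr.var 9) (Expr.var 11)) (cell 0 (Expr.var 10) (Expr.var 11)))
      (push 9 11) skip)
    (cond (lt (cell 0 (Expr.var 10) (Expr.var 11)) (cell 0 (Expr.var 9) (Expr.var 11)))
      (push 11 10) skip)

/-- Process the first pair of the queue. -/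
def processHead : Prog :=
  seq (assign 9 (read 2 (Expr.var 7)))
    (seq (assign 10 (read 3 (Expr.var 7)))
      (seq (assign 7 (add (Expr.var 7) (const 1))) (forLoop 11 0 forceBody)))

/-- Orient the pair of the variables `5`, `6` if it is not yet oriented, and pass to the next
pair. -/
def nextSeed : Prog :=
  cond (lt (Expr.var 6) (Expr.var 0))
    (seq (cond (lt (add (cell 0 (Expr.var 5) (Expr.var 6)) (cell 1 (Expr.var 6) (Expr.var 5)))
          (add (lt (Expr.var 5) (Expr.var 6)) (lt (Expr.var 6) (Expr.var 5))))
        (push 5 6) skip)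
      (assign 6 (add (Expr.var 6) (const 1))))
    (seq (assign 6 (const 0)) (assign 5 (add (Expr.var 5) (const 1))))

/-- Compute the lexicographic orientation of the complement in the array `1`. -/
def orient : Prog :=
  loop (add (lt (Expr.var 5) (Expr.var 0)) (lt (Expr.var 7) (Expr.var 8)))
    (cond (lt (Expr.var 7) (Expr.var 8)) processHead nextSeed)

/-- The array `0` holds the adjacency matrix of `G`, and the list `L` of the pairs that have been
oriented is stored in the queue and in the array `1`. -/
structure Holds {n : ℕ} (G : SimpleGraph (Fin n)) (L : List (Fin n × Fin n)) (s : State) :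
    Prop where
  size : s.var 0 = n
  adj : ∀ u v : Fin n, s.arr 0 (u * n + v) = if G.Adj u v then 1 else 0
  nodup : L.Nodup
  tail : s.var 8 = L.length
  mem : ∀ u v : Fin n, s.arr 1 (u * n + v) = if (u, v) ∈ L then 1 else 0
  queue : ∀ m (h : m < L.length), s.arr 2 m = L[m].1 ∧ s.arr 3 m = L[m].2

variable {n W : ℕ} {G : SimpleGraph (Fin n)} {L : List (Fin n × Fin n)} {s : State}

/-- No pair is queued twice; this bounds both the queue pointers and the number of pairs to process.
-/
theorem Holds.length_le (h : Holds G L s) : L.length ≤ n * n := by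
  simpa using h.nodup.length_le_card

theorem index_le {u v n : ℕ} (hu : u ≤ n) (hv : v < n) : u * n + v ≤ n * n + n := by
  have := Nat.mul_le_mul_right n hu
  omega

theorem fin_index_le (u v : Fin n) : (u : ℕ) * n + v ≤ n * n + n :=
  index_le u.2.le v.2

theorem fin_index_inj {u v u' v' : Fin n} :
    (u : ℕ) * n + v = u' * n + v' ↔ (u, v) = (u', v') := by
  constructor
  · intro h
    have := index_inj v.2 v'.2 h
    rw [Prod.mk.injEq, Fin.ext_iff, Fin.ext_iff]
    exact this
  · intro h
    rw [Prod.mk.injEq] at h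
    rw [h.1, h.2]

/-- The list `L` extended by `p` unless it contains `p`. -/
def pushList (L : List (Fin n × Fin n)) (p : Fin n × Fin n) : List (Fin n × Fin n) :=
  if p ∈ L then L else L ++ [p]

theorem prefix_pushList (L : List (Fin n × Fin n)) (p : Fin n × Fin n) : L <+: pushList L p := by
  unfold pushList
  split_ifs
  · exact List.prefix_refl _
  · exact List.prefix_append _ _

theorem mem_pushList (L : List (Fin n × Fin n)) (p : Fin n × Fin n) : p ∈ pushList L p := by
  unfold pushList
  split_ifs with h
  · exact h
  · simp

theorem Holds.ends_push (h : Holds G L s) (hW : 10 * (n * n) + 10 * n + 10 ≤ W) {x y : ℕ}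
    {u v : Fin n} (hu : s.var x = u) (hv : s.var y = v) :
    Ends W (push x y) s 24 (Holds G (pushList L (u, v))) := by
  have hi := fin_index_le u v
  have hlen := h.length_le
  have e1 := h.mem u v
  have hun : (u : ℕ) * n ≤ n * n := Nat.mul_le_mul_right n u.2.le
  refine Ends.mono (Ends.cond (T := 1) (T' := 17) ?_ ?_ ?_) (by simp [cell, cost]) fun _ h => h
  · simp only [cell, Fits, eval, hu, hv, h.size, e1]
    refine ⟨⟨⟨?_, ?_, ?_⟩, ?_, ?_⟩, ?_⟩ <;> try omega
    split_ifs <;> omega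
  · intro hne
    have hm : (u, v) ∈ L := by
      by_contra hm
      simp [cell, eval, hu, hv, h.size, e1, hm] at hne
    rw [pushList, if_pos hm]
    exact Ends.skip h
  · intro heq
    have hm : (u, v) ∉ L := by
      intro hm
      simp [cell, eval, hu, hv, h.size, e1, hm] at heq
    rw [pushList, if_neg hm]
    refine Ends.mono (T := 7 + (3 + (3 + 4))) (Ends.seq (Ends.write ?_ ?_
      (Ends.seq (Ends.write ?_ ?_ (Ends.seq (Ends.write ?_ ?_ (Ends.assign ?_ ?_)))))))
      le_rfl fun _ h => h
    · simp only [Fits, eval, hu, hv, h.size]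
      omega
    · simp only [Fits]
      omega
    · simp only [Fits, h.tail]
      omega
    · simp only [Fits, hu]
      omega
    · simp only [Fits, h.tail]
      omega
    · simp only [Fits, hv]
      omega
    · simp only [Fits, eval, h.tail]
      omega
    · simp only [eval, hu, hv, h.size, h.tail]
      refine ⟨?_, ?_, ?_, ?_, ?_, ?_⟩
      · simpa using h.size
      · simpa [Function.update_apply] using h.adj
      · rw [List.nodup_append]
        refine ⟨h.nodup, by simp, ?_⟩
        intro a ha b hb
        rw [List.mem_singleton] at hb
        rintro rfl
        exact hm (hb ▸ ha)
      · simp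
      · intro u' v'
        have e2 : Function.update (s.arr 1) ((u : ℕ) * n + v) 1 ((u' : ℕ) * n + v') =
            if (u', v') ∈ L ++ [(u, v)] then 1 else 0 := by
          rw [Function.update_apply, h.mem]
          simp only [fin_index_inj, List.mem_append, List.mem_singleton]
          by_cases hp : (u', v') = (u, v) <;> simp [hp]
        simpa using e2
      · intro m hmlt
        simp only [List.length_append, List.length_singleton] at hmlt
        by_cases hml : m = L.length
        · subst hml
          simp
        · have hlt : m < L.length := by omega
          have := h.queue m hlt
          simp [hml, List.getElem_append_left hlt, this]

/-- A conditional push of a pair that extends the partial orientation. -/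
theorem Holds.ends_cond_push (h : Holds G L s) (hL : G.PartialOrientation L)
    (hW : 10 * (n * n) + 10 * n + 10 ≤ W) {x y : ℕ} {u v : Fin n}
    (hu : s.var x = u) (hv : s.var y = v) {e : Expr} (he : e.Fits W s) (φ : Prop)
    (hφ : e.eval s ≠ 0 ↔ φ) (hp : φ → (u, v) ∉ L → G.PartialOrientation (L ++ [(u, v)])) :
    Ends W (cond e (push x y) skip) s (e.cost + 25) fun s' => ∃ L', L <+: L' ∧ Holds G L' s' ∧
      G.PartialOrientation L' ∧ (φ → (u, v) ∈ L') := by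
  refine Ends.mono (Ends.cond (T := 24) (T' := 1) he (fun hne => ?_) fun heq => ?_) (by simp)
    fun _ h => h
  · refine (h.ends_push hW hu hv).mono le_rfl fun s' hs' =>
      ⟨_, prefix_pushList _ _, hs', ?_, fun _ => mem_pushList _ _⟩
    unfold pushList
    split_ifs with hm
    · exact hL
    · exact hp (hφ.1 hne) hm
  · exact Ends.skip ⟨L, List.prefix_refl _, h, hL, fun hc => absurd heq (hφ.2 hc)⟩

theorem Holds.cell_zero (h : Holds G L s) {x y : ℕ} {u v : Fin n} (hu : s.var x = u)
    (hv : s.var y = v) :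
    (cell 0 (Expr.var x) (Expr.var y)).eval s = if G.Adj u v then 1 else 0 := by
  simp only [cell, eval, hu, hv, h.size, h.adj]

theorem Holds.cell_one (h : Holds G L s) {x y : ℕ} {u v : Fin n} (hu : s.var x = u)
    (hv : s.var y = v) :
    (cell 1 (Expr.var x) (Expr.var y)).eval s = if (u, v) ∈ L then 1 else 0 := by
  simp only [cell, eval, hu, hv, h.size, h.mem]

theorem fits_cell {x y a : ℕ} {u v : ℕ} (hn : s.var 0 = n) (hu : s.var x = u)
    (hv : s.var y = v) (hun : u ≤ n) (hvn : v < n) (hW : 10 * (n * n) + 10 * n + 10 ≤ W)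
    (ha : s.arr a (u * n + v) ≤ W) : (cell a (Expr.var x) (Expr.var y)).Fits W s := by
  have hi := index_le hun hvn
  have hun : u * n ≤ n * n := Nat.mul_le_mul_right n hun
  simp only [cell, Fits, eval, hu, hv, hn]
  refine ⟨⟨⟨?_, ?_, ?_⟩, ?_, ?_⟩, ha⟩ <;> omega

theorem Holds.fits_zero (h : Holds G L s) {x y : ℕ} {u v : Fin n} (hu : s.var x = u)
    (hv : s.var y = v) (hW : 10 * (n * n) + 10 * n + 10 ≤ W) :
    (cell 0 (Expr.var x) (Expr.var y)).Fits W s :=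
  fits_cell h.size hu hv u.2.le v.2 hW (by rw [h.adj]; split_ifs <;> omega)

theorem Holds.fits_one (h : Holds G L s) {x y : ℕ} {u v : Fin n} (hu : s.var x = u)
    (hv : s.var y = v) (hW : 10 * (n * n) + 10 * n + 10 ≤ W) :
    (cell 1 (Expr.var x) (Expr.var y)).Fits W s :=
  fits_cell h.size hu hv u.2.le v.2 hW (by rw [h.mem]; split_ifs <;> omega)

/-- For 0/1 entries, strict inequality between rows b and c in column k says that k is adjacent to
exactly one prescribed endpoint. The two directions are the two forcing rules. -/
theorem Holds.ends_forceBody (h : Holds G L s) (hL : G.PartialOrientation L)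
    {D : Fin n × Fin n → Prop} (hD : G.IsCoOrder D)
    (hW : 10 * (n * n) + 10 * n + 10 ≤ W) {b c k : Fin n} (hb : s.var 9 = b) (hc : s.var 10 = c)
    (hk : s.var 11 = k) (hbc : (b, c) ∈ L) :
    Ends W forceBody s 80 fun s' => ∃ L', L <+: L' ∧ Holds G L' s' ∧
      G.PartialOrientation L' ∧ (G.Adj c k → ¬ G.Adj b k → (b, k) ∈ L') ∧
      (G.Adj b k → ¬ G.Adj c k → (k, c) ∈ L') := by
  refine Ends.mono (Ends.seq (Ends.mono (Ends.frame (h.ends_cond_push hL hW (x := 9) (y := 11)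
    (u := b) (v := k) hb hk ?_
    (G.Adj c k ∧ ¬ G.Adj b k) ?_ ?_)) le_rfl ?_)) (T := 38 + 38) (by norm_num) fun _ h => h
  · exact ⟨h.fits_zero hb hk hW, h.fits_zero hc hk hW, by omega⟩
  · rw [eval, h.cell_zero hb hk, h.cell_zero hc hk]
    by_cases h1 : G.Adj b k <;> by_cases h2 : G.Adj c k <;> simp [h1, h2]
  · rintro ⟨h1, h2⟩ -
    exact hL.append_force hD hbc (Force.right h1 h2)
  · rintro s1 ⟨⟨L1, hp1, hh1, hL1, hm1⟩, hF⟩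
    have hb1 : s1.var 9 = b := (hF.1 9 (by decide)).trans hb
    have hc1 : s1.var 10 = c := (hF.1 10 (by decide)).trans hc
    have hk1 : s1.var 11 = k := (hF.1 11 (by decide)).trans hk
    have hbc1 := hp1.subset hbc
    refine Ends.mono (hh1.ends_cond_push hL1 hW (x := 11) (y := 10) (u := k) (v := c)
      hk1 hc1 ?_ (G.Adj b k ∧ ¬ G.Adj c k) ?_ ?_) le_rfl ?_
    · exact ⟨hh1.fits_zero hc1 hk1 hW, hh1.fits_zero hb1 hk1 hW, by omega⟩
    · rw [eval, hh1.cell_zero hb1 hk1, hh1.cell_zero hc1 hk1]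
      by_cases h1 : G.Adj b k <;> by_cases h2 : G.Adj c k <;> simp [h1, h2]
    · rintro ⟨h1, h2⟩ -
      exact hL1.append_force hD hbc1 (Force.left h1 h2)
    · rintro s2 ⟨L2, hp2, hh2, hL2, hm2⟩
      exact ⟨L2, hp1.trans hp2, hh2, hL2, fun h1 h2 => hp2.subset (hm1 ⟨h1, h2⟩),
        fun h1 h2 => hm2 ⟨h1, h2⟩⟩

theorem Holds.of_eq (h : Holds G L s) {s' : State} (h0 : s'.var 0 = s.var 0)
    (h8 : s'.var 8 = s.var 8) (ha : s'.arr = s.arr) : Holds G L s' := by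
  obtain ⟨a1, a2, a3, a4, a5, a6⟩ := h
  exact ⟨by rw [h0, a1], by rwa [ha], a3, by rw [h8, a4], by rwa [ha], by rwa [ha]⟩

theorem Holds.ends_processHead (h : Holds G L s) (hL : G.PartialOrientation L)
    {D : Fin n × Fin n → Prop} (hD : G.IsCoOrder D)
    (hW : 10 * (n * n) + 10 * n + 10 ≤ W) (hhead : s.var 7 < L.length) :
    Ends W processHead s (n * 90 + 20) fun s' => ∃ L', L <+: L' ∧ Holds G L' s' ∧
      G.PartialOrientation L' ∧ s'.var 7 = s.var 7 + 1 ∧ s'.var 5 = s.var 5 ∧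
      s'.var 6 = s.var 6 ∧ ∀ q, G.Force L[s.var 7] q → q ∈ L' := by
  have hlen := h.length_le
  obtain ⟨hq2, hq3⟩ := h.queue _ hhead
  obtain ⟨b, c, hbc⟩ : ∃ b c, L[s.var 7] = (b, c) := ⟨_, _, rfl⟩
  have hmem : (b, c) ∈ L := hbc ▸ List.getElem_mem hhead
  rw [hbc] at hq2 hq3
  simp only at hq2 hq3
  have hb := b.2
  have hc := c.2
  refine Ends.mono (T := 3 + (3 + (4 + ((n + 0) * (80 + 10) + 8))))
    (Ends.seq (Ends.assign ?_ (Ends.seq (Ends.assign ?_ (Ends.seq (Ends.assign ?_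
      (Ends.mono (Ends.forLoop (n := n) (fun i s' => ∃ L', L <+: L' ∧ Holds G L' s' ∧
        G.PartialOrientation L' ∧ ∀ k : Fin n, (k : ℕ) < i →
          (G.Adj c k → ¬ G.Adj b k → (b, k) ∈ L') ∧ (G.Adj b k → ¬ G.Adj c k → (k, c) ∈ L'))
        ?_ ?_ ?_ ?_ ?_ ?_ ?_) le_rfl ?_)))))))
    (by simp only [add_zero]; omega) fun _ h => h
  · simp only [Fits, eval]
    omega
  · simp [Fits, eval]
    omega
  · simp [Fits, eval]
    omega
  · simpa using h.size
  · norm_num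
  · decide
  · decide
  · omega
  · exact ⟨L, List.prefix_refl _, h.of_eq (by simp) (by simp) rfl, hL, by simp⟩
  · rintro i hi s1 - h11 hF ⟨L1, hp1, hh1, hL1, hm1⟩
    have hb1 : s1.var 9 = b := by
      rw [hF.1 9 (by decide)]
      simpa [eval] using hq2
    have hc1 : s1.var 10 = c := by
      rw [hF.1 10 (by decide)]
      simpa [eval] using hq3
    refine (hh1.ends_forceBody hL1 hD hW hb1 hc1 (k := ⟨i, hi⟩) h11 (hp1.subset hmem)).mono
      le_rfl ?_
    rintro s2 ⟨L2, hp2, hh2, hL2, hm2⟩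
    refine ⟨L2, hp1.trans hp2, hh2.of_eq (by simp) (by simp) rfl, hL2, fun k hk => ?_⟩
    rcases Nat.lt_succ_iff_lt_or_eq.1 hk with hk | rfl
    · exact ⟨fun h1 h2 => hp2.subset ((hm1 k hk).1 h1 h2),
        fun h1 h2 => hp2.subset ((hm1 k hk).2 h1 h2)⟩
    · exact hm2
  · rintro s1 ⟨⟨L1, hp1, hh1, hL1, hm1⟩, hF⟩
    refine ⟨L1, hp1, hh1, hL1, ?_, ?_, ?_, ?_⟩
    · rw [hF.1 7 (by decide)]
      simp [eval]
    · rw [hF.1 5 (by decide)]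
      simp [eval]
    · rw [hF.1 6 (by decide)]
      simp [eval]
    · intro q hq
      rw [hbc] at hq
      cases hq with
      | right h1 h2 => exact (hm1 _ (by simp)).1 h1 h2
      | left h1 h2 => exact (hm1 _ (by simp)).2 h1 h2

/-- The part of the invariant of `orient` that concerns the pairs that have been treated: those
before the pair `(i, j)` are oriented, and the forced pairs of the first `h` pairs of the queue
are in the queue. -/
structure Treated {n : ℕ} (G : SimpleGraph (Fin n)) (L : List (Fin n × Fin n)) (i j h : ℕ) :
    Prop where
  le : h ≤ L.length
  force : ∀ p ∈ L.take h, ∀ q, G.Force p q → q ∈ L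
  done : ∀ p : Fin n × Fin n, G.NonEdge p → ((p.1 : ℕ) < i ∨ (p.1 : ℕ) = i ∧ (p.2 : ℕ) < j) →
    p ∈ L ∨ p.swap ∈ L

theorem Treated.of_prefix {L' : List (Fin n × Fin n)} {i j h : ℕ} (ht : Treated G L i j h)
    (hp : L <+: L') : Treated G L' i j h := by
  obtain ⟨R, rfl⟩ := hp
  refine ⟨?_, ?_, ?_⟩
  · rw [List.length_append]
    exact ht.le.trans (Nat.le_add_right _ _)
  · rw [List.take_append_of_le_length ht.le]
    exact fun p hp q hq => List.mem_append_left _ (ht.force p hp q hq)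
  · intro p hp hij
    rcases ht.done p hp hij with h | h
    · exact Or.inl (List.mem_append_left _ h)
    · exact Or.inr (List.mem_append_left _ h)

theorem Holds.ends_nextSeed (h : Holds G L s) (hL : G.PartialOrientation L)
    {D : Fin n × Fin n → Prop} (hD : G.IsCoOrder D) (hW : 10 * (n * n) + 10 * n + 10 ≤ W)
    (ht : Treated G L (s.var 5) (s.var 6) (s.var 7)) (hhead : L.length ≤ s.var 7)
    (h5 : s.var 5 < n) (h6 : s.var 6 ≤ n) :
    Ends W nextSeed s 60 fun s' => ∃ L', Holds G L' s' ∧ G.PartialOrientation L' ∧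
      Treated G L' (s'.var 5) (s'.var 6) (s'.var 7) ∧ s'.var 7 = s.var 7 ∧
      (s.var 6 < n ∧ s'.var 5 = s.var 5 ∧ s'.var 6 = s.var 6 + 1 ∨
        s.var 6 = n ∧ s'.var 5 = s.var 5 + 1 ∧ s'.var 6 = 0) := by
  have hcl : ∀ p ∈ L, ∀ q, G.Force p q → q ∈ L := by
    have := ht.force
    rwa [List.take_of_length_le hhead] at this
  refine Ends.mono (Ends.cond (T := 54) (T' := 6) ?_ (fun hne => ?_) fun heq => ?_)
    (by simp [cost]) fun _ h => h
  · simp only [Fits, h.size]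
    omega
  · have h6 : s.var 6 < n := by
      by_contra hc
      simp [eval, h.size, hc] at hne
    obtain ⟨u, hu⟩ : ∃ u : Fin n, s.var 5 = u := ⟨⟨_, h5⟩, rfl⟩
    obtain ⟨v, hv⟩ : ∃ v : Fin n, s.var 6 = v := ⟨⟨_, h6⟩, rfl⟩
    refine Ends.mono (T := 50 + 4) (Ends.seq (Ends.mono (Ends.frame (h.ends_cond_push hL hW
      (x := 5) (y := 6) (u := u) (v := v) hu hv ?_ (G.NonEdge (u, v) ∧ (v, u) ∉ L) ?_ ?_))
      (by simp [cell, cost]) ?_)) le_rfl fun _ h => h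
    · have e1 := h.cell_zero hu hv
      have e2 := h.cell_one hv hu
      have hu2 := u.2
      have hv2 := v.2
      refine ⟨⟨h.fits_zero hu hv hW, h.fits_one hv hu hW, ?_⟩, ⟨?_, ?_, ?_⟩, ?_⟩
      · rw [e1, e2]
        split_ifs <;> omega
      · simp only [Fits, hu, hv]
        omega
      · simp only [Fits, hu, hv]
        omega
      · exact (Nat.add_le_add (eval_lt_le _ _ _) (eval_lt_le _ _ _)).trans (by omega)
      · omega
    -- The right side of the test is 1 if u ≠ v and 0 if u = v. So the test asks that u ≠ v, that u
    -- and v are not adjacent and that (v, u) is not oriented; `push` itself checks (u, v).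
    · rw [eval, eval, eval, eval, eval, h.cell_zero hu hv, h.cell_one hv hu]
      simp only [eval, hu, hv, NonEdge, Fin.val_fin_lt]
      rcases lt_trichotomy u v with h1 | h1 | h1
      · by_cases h2 : G.Adj u v <;> by_cases h3 : (v, u) ∈ L <;>
          simp [h1, h1.not_gt, h1.ne, h2, h3]
      · simp [h1]
      · by_cases h2 : G.Adj u v <;> by_cases h3 : (v, u) ∈ L <;>
          simp [h1, h1.not_gt, h1.ne', h2, h3]
    · rintro ⟨h1, h2⟩ h3
      refine hL.append_seed hD hcl h1 h3 h2 fun q hq hlt => ht.done q hq (Or.inl ?_)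
      rw [hu]
      exact hlt
    · rintro s1 ⟨⟨L1, hp1, hh1, hL1, hm1⟩, hF⟩
      have e5 : s1.var 5 = u := (hF.1 5 (by decide)).trans hu
      have e6 : s1.var 6 = v := (hF.1 6 (by decide)).trans hv
      have e7 : s1.var 7 = s.var 7 := hF.1 7 (by decide)
      have hv2 := v.2
      refine Ends.assign ?_ ⟨L1, hh1.of_eq (by simp) (by simp) rfl, hL1, ?_, ?_, ?_⟩
      · simp only [Fits, eval, e6]
        omega
      · have ht1 := ht.of_prefix hp1
        simp only [eval, e5, e6, e7, Function.update_self, ne_eq, Function.update_of_ne,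
          Nat.reduceEqDiff, not_false_eq_true]
        refine ⟨ht1.le, ht1.force, fun p hp hij => ?_⟩
        by_cases hpe : (p.1 : ℕ) = u ∧ (p.2 : ℕ) = v
        · obtain rfl : p = (u, v) := Prod.ext (Fin.ext hpe.1) (Fin.ext hpe.2)
          by_cases h3 : (v, u) ∈ L
          · exact Or.inr (hp1.subset h3)
          · exact Or.inl (hm1 ⟨hp, h3⟩)
        · refine ht1.done p hp ?_
          rw [hu, hv]
          omega
      · simp [e7]
      · refine Or.inl ⟨h6, ?_, ?_⟩
        · simp [e5, hu]
        · simp [eval, e6, hv]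
  · have h6 : s.var 6 = n := by
      by_contra hc
      have : s.var 6 < n := by omega
      simp [eval, h.size, this] at heq
    refine Ends.mono (T := 2 + 4) (Ends.seq (Ends.assign (by simp [Fits]) (Ends.assign ?_
      ⟨L, h.of_eq (by simp) (by simp) rfl, hL, ?_, ?_, Or.inr ⟨h6, ?_, ?_⟩⟩))) le_rfl
      fun _ h => h
    · simp [Fits, eval]
      omega
    · simp only [eval, Function.update_self, ne_eq, Function.update_of_ne,
        Nat.reduceEqDiff, not_false_eq_true]
      refine ⟨ht.le, ht.force, fun p hp hij => ht.done p hp ?_⟩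
      have := p.2.2
      omega
    · simp
    · simp [eval]
    · simp [eval]

/-- The program `orient` computes a lexicographic orientation. -/
theorem ends_orient {D : Fin n × Fin n → Prop} (hD : G.IsCoOrder D)
    (hW : 10 * (n * n) + 10 * n + 10 ≤ W) (h : Holds G [] s) (h5 : s.var 5 = 0)
    (h6 : s.var 6 = 0) (h7 : s.var 7 = 0) :
    Ends W orient s ((n * (n + 1) + n + n * n) * (n * 90 + 72) + 8) fun s' =>
      ∃ L, Holds G L s' ∧ G.IsLexOrientation fun p => p ∈ L := by
  have hloop := Ends.loop (W := W) (s := s) (T := n * 90 + 64)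
    (e := add (lt (Expr.var 5) (Expr.var 0)) (lt (Expr.var 7) (Expr.var 8)))
    (P := cond (lt (Expr.var 7) (Expr.var 8)) processHead nextSeed)
    (fun s' => ∃ L, Holds G L s' ∧ G.PartialOrientation L ∧
      Treated G L (s'.var 5) (s'.var 6) (s'.var 7) ∧ s'.var 5 ≤ n ∧ s'.var 6 ≤ n)
    -- Advancing the queue or the column lowers one term by 1; a new row lowers the first term by n
    -- + 1 and raises the second by n. The variant starts at O(n²) and a round costs O(n).
    (fun s' => (n - s'.var 5) * (n + 1) + (n - s'.var 6) + (n * n - s'.var 7)) ?_ ?_ ?_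
  · refine Ends.mono hloop ?_ ?_
    · simp [cost, h5, h6, h7]
    · rintro s' ⟨⟨L, hh, hL, ht, h5, h6⟩, he⟩
      have h5 : n ≤ s'.var 5 := by
        by_contra hc
        simp [eval, hh.size, not_le.1 hc] at he
      have h7 : L.length ≤ s'.var 7 := by
        by_contra hc
        simp [eval, hh.tail, not_le.1 hc] at he
      refine ⟨L, hh, hL.nonEdge, fun p hp => ht.done p hp (Or.inl (by omega)), ?_, ?_, hL.seed_and⟩
      · intro p hp hp'
        exact hL.anti p hp p.swap hp' (by rw [Prod.swap_swap]; exact Relation.ReflTransGen.refl)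
      · intro p q hp
        refine ht.force p ?_ q
        rwa [List.take_of_length_le h7]
  · rintro s' ⟨L, hh, hL, ht, h5, h6⟩
    have h7 := ht.le
    have h8 := hh.tail
    have h9 := hh.length_le
    refine ⟨⟨?_, ?_, ?_⟩, ⟨?_, ?_, ?_⟩,
      (Nat.add_le_add (eval_lt_le _ _ _) (eval_lt_le _ _ _)).trans (by omega)⟩ <;>
      (try simp only [Fits, hh.size]) <;> omega
  · rintro s' ⟨L, hh, hL, ht, h5, h6⟩ hne
    have h7 := ht.le
    have h8 := hh.tail
    have h9 := hh.length_le
    refine Ends.mono (Ends.cond (T := n * 90 + 20) (T' := 60) ?_ (fun hlt => ?_) fun hlt => ?_)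
      (by simp only [cost]; omega) fun _ h => h
    · simp only [Fits]
      omega
    · have hlt : s'.var 7 < L.length := by
        by_contra hc
        simp [eval, h8, hc] at hlt
      refine (hh.ends_processHead hL hD hW hlt).mono le_rfl ?_
      rintro s1 ⟨L1, hp1, hh1, hL1, e7, e5, e6, hf⟩
      refine ⟨⟨L1, hh1, hL1, ?_, e5 ▸ h5, e6 ▸ h6⟩, ?_⟩
      · have ht1 := ht.of_prefix hp1
        have hlt1 := hlt.trans_le hp1.length_le
        rw [e5, e6, e7]
        refine ⟨hlt1, fun p hp q hq => ?_, ht1.done⟩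
        rw [List.take_succ_eq_append_getElem hlt1, List.mem_append, List.mem_singleton] at hp
        rcases hp with hp | rfl
        · exact ht1.force p hp q hq
        · rw [← hp1.getElem hlt] at hq
          exact hf q hq
      · rw [e5, e6, e7]
        omega
    · have hge : L.length ≤ s'.var 7 := by
        by_contra hc
        simp [eval, h8, not_le.1 hc] at hlt
      have h5' : s'.var 5 < n := by
        by_contra hc
        simp [eval, h8, hh.size, hc, hge] at hne
      refine (hh.ends_nextSeed hL hD hW ht hge h5' h6).mono le_rfl ?_
      rintro s1 ⟨L1, hh1, hL1, ht1, e7, hcase⟩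
      refine ⟨⟨L1, hh1, hL1, ht1, ?_, ?_⟩, ?_⟩
      · omega
      · omega
      · rw [e7]
        rcases hcase with ⟨h10, e5, e6⟩ | ⟨h10, e5, e6⟩
        · rw [e5, e6]
          omega
        · rw [e5, e6]
          obtain ⟨m, hm⟩ : ∃ m, n - s'.var 5 = m + 1 := ⟨n - s'.var 5 - 1, by omega⟩
          have hm' : n - (s'.var 5 + 1) = m := by omega
          rw [hm, hm', add_mul]
          omega
  · refine ⟨[], h, ⟨by simp, by simp, by simp⟩, ⟨by simp [h7], by simp, ?_⟩, by omega, by omega⟩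
    intro p _ hij
    omega

end RAM

/-! ### The dynamic program and the final result -/

namespace RAM

open RAM.Expr RAM.Prog Finset

/-- Compute the numbers `|N(v) \ N(u)|` in the array `4`; row `n` holds the degrees. -/
def weightBody : Prog :=
  seq (assign 12 (const 0))
    (seq (forLoop 11 0 (assign 12 (add (Expr.var 12)
        (lt (cell 0 (Expr.var 5) (Expr.var 11)) (cell 0 (Expr.var 6) (Expr.var 11))))))
      (Prog.write 4 (add (mul (Expr.var 5) (Expr.var 0)) (Expr.var 6)) (Expr.var 12)))

/-- The number of columns in which the row `v` of the table `A` exceeds the row `u`. -/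
def weightTable (A : ℕ → ℕ) (n u v : ℕ) : ℕ :=
  ∑ k ∈ range n, if A (u * n + k) < A (v * n + k) then 1 else 0

theorem weightTable_le (A : ℕ → ℕ) (n u v : ℕ) : weightTable A n u v ≤ n := by
  refine (sum_le_card_nsmul _ _ 1 fun k _ => ?_).trans (by simp)
  split_ifs <;> simp

variable {n W : ℕ} {s : State}

theorem ends_weights (hn : s.var 0 = n) (hA : ∀ m, s.arr 0 m ≤ 1)
    (hW : 10 * (n * n) + 10 * n + 10 ≤ W) :
    Ends W (forLoop 5 1 (forLoop 6 0 weightBody)) s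
      ((n + 1) * (n * (n * 26 + 27) + 18) + 8) fun s' =>
      (∀ u < n + 1, ∀ v < n, s'.arr 4 (u * n + v) = weightTable (s.arr 0) n u v) ∧
        Frame [5, 6, 11, 12] [4] s s' := by
  refine Ends.mono (Ends.table (x := 5) (y := 6) (a := 4) (c := 1) (T := n * 26 + 17)
    (weightTable (s.arr 0) n) hn (by decide) (by decide) (by decide) (by decide) (by decide)
    (by decide) (by omega) ?_) le_rfl ?_
  · intro u hu v hv s1 h0 h5 h6 hF _
    have hA1 : s1.arr 0 = s.arr 0 := hF.2 0 (by decide)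
    have hi := index_le (Nat.lt_succ_iff.1 hu) hv
    have hun : u * n ≤ n * n := Nat.mul_le_mul_right n (Nat.lt_succ_iff.1 hu)
    refine Ends.mono (T := 2 + (((n + 0) * (16 + 10) + 8) + 7)) (Ends.seq (Ends.assign (by simp [Fits])
      (Ends.seq (Ends.mono (Ends.forLoop (n := n) (fun i s' => s'.var 12 =
        ∑ k ∈ range i, if s.arr 0 (u * n + k) < s.arr 0 (v * n + k) then 1 else 0) ?_ (by decide)
        (by decide) (by decide) (by omega) ?_ ?_) le_rfl ?_)))) (by omega) fun _ h => h
    · simpa using h0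
    · simp [eval]
    · intro i hi s2 h20 h211 hF2 hI
      have e5 : s2.var 5 = u := by rw [hF2.1 5 (by decide)]; simpa using h5
      have e6 : s2.var 6 = v := by rw [hF2.1 6 (by decide)]; simpa using h6
      have eA : s2.arr 0 = s.arr 0 := by rw [hF2.2 0 (by decide)]; exact hA1
      have hle : s2.var 12 ≤ i := by
        rw [hI]
        refine (sum_le_card_nsmul _ _ 1 fun k _ => ?_).trans (by simp)
        split_ifs <;> simp
      refine Ends.mono (Ends.assign ?_ ?_) (by simp [cell, cost]) fun _ h => h
      · have hl := eval_lt_le s2 (cell 0 (Expr.var 5) (Expr.var 11))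
          (cell 0 (Expr.var 6) (Expr.var 11))
        refine ⟨?_, ⟨?_, ?_, ?_⟩, ?_⟩
        · simp only [Fits]
          omega
        · exact fits_cell h20 e5 h211 (by omega) hi hW ((eA ▸ hA _).trans (by omega))
        · exact fits_cell h20 e6 h211 hv.le hi hW ((eA ▸ hA _).trans (by omega))
        · omega
        · refine (Nat.add_le_add hle hl).trans (by omega)
      · simp only [eval, cell, Function.update_self, ne_eq, Function.update_of_ne,
          Nat.reduceEqDiff, not_false_eq_true, hI, sum_range_succ, h20, h211, e5, e6, eA]
    · rintro s2 ⟨hI, hF2⟩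
      have e0 : s2.var 0 = n := by rw [hF2.1 0 (by decide)]; simpa using h0
      have e5 : s2.var 5 = u := by rw [hF2.1 5 (by decide)]; simpa using h5
      have e6 : s2.var 6 = v := by rw [hF2.1 6 (by decide)]; simpa using h6
      have e4 : s2.arr 4 = s1.arr 4 := hF2.2 4 (by decide)
      have e12 : s2.var 12 = weightTable (s.arr 0) n u v := hI
      have hle := weightTable_le (s.arr 0) n u v
      refine Ends.mono (Ends.write ?_ ?_ ?_) (by simp [cost]) fun _ h => h
      · simp only [Fits, eval, e0, e5, e6]
        omega
      · simp only [Fits, e12]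
        omega
      · simp only [eval, e0, e5, e6, e12, e4, Function.update_self]
  · rintro s' ⟨h1, h2⟩
    exact ⟨h1, h2.mono (by decide) (by decide)⟩

/-- Compute an entry of the table of `chainGain` in the array `5`. -/
def gainBody : Prog :=
  cond (Expr.var 5)
    (seq (assign 12 (const 0))
      (seq (forLoop 11 0
        (seq (assign 13 (mul (cell 1 (Expr.var 11) (Expr.var 6))
            (sub (cell 5 (sub (Expr.var 5) (const 1)) (Expr.var 11))
              (cell 4 (Expr.var 11) (Expr.var 6)))))
          (cond (lt (Expr.var 12) (Expr.var 13)) (assign 12 (Expr.var 13)) skip)))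
        (Prog.write 5 (add (mul (Expr.var 5) (Expr.var 0)) (Expr.var 6)) (Expr.var 12))))
    (Prog.write 5 (add (mul (Expr.var 5) (Expr.var 0)) (Expr.var 6))
      (sub (add (Expr.var 0) (const 1)) (cell 4 (Expr.var 0) (Expr.var 6))))

/-- The recursion of `chainGain` in terms of the tables `D` of the orientation and `w` of the
weights. -/
def gainTable (D w : ℕ → ℕ) (n : ℕ) : ℕ → ℕ → ℕ
  | 0, v => n + 1 - w (n * n + v)
  | s + 1, v => (range n).sup fun u => D (u * n + v) * (gainTable D w n s u - w (u * n + v))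

theorem gainTable_le {D w : ℕ → ℕ} {n s v : ℕ} (hD : ∀ u < n, ∀ v < n, D (u * n + v) ≤ 1)
    (hv : v < n) : gainTable D w n s v ≤ n + 1 := by
  induction s generalizing v with
  | zero => exact Nat.sub_le _ _
  | succ s ih =>
    refine Finset.sup_le fun u hu => ?_
    have hu := Finset.mem_range.1 hu
    exact (Nat.mul_le_mul (hD u hu v hv) ((Nat.sub_le _ _).trans (ih hu))).trans (by simp)

/-- Rows are filled by increasing chain size, so an entry reads only the finished previous row.
Multiplication by the 0/1 entry of the orientation discards the vertices that are not below v. -/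
theorem ends_gains (hn : s.var 0 = n) (hD : ∀ u < n, ∀ v < n, s.arr 1 (u * n + v) ≤ 1)
    (hw : ∀ u < n + 1, ∀ v < n, s.arr 4 (u * n + v) ≤ n)
    (hW : 10 * (n * n) + 10 * n + 10 ≤ W) :
    Ends W (forLoop 5 0 (forLoop 6 0 gainBody)) s
      (n * (n * (n * 50 + 50) + 18) + 8) fun s' =>
      (∀ u < n, ∀ v < n, s'.arr 5 (u * n + v) = gainTable (s.arr 1) (s.arr 4) n u v) ∧
        Frame [5, 6, 11, 12, 13] [5] s s' := by
  refine Ends.mono (Ends.table (x := 5) (y := 6) (a := 5) (c := 0) (T := n * 50 + 40)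
    (gainTable (s.arr 1) (s.arr 4) n) hn (by decide) (by decide) (by decide) (by decide)
    (by decide) (by decide) (by omega) ?_) (by simp) ?_
  · intro u hu v hv s1 h0 h5 h6 hF hprev
    have e1 : s1.arr 1 = s.arr 1 := hF.2 1 (by decide)
    have e4 : s1.arr 4 = s.arr 4 := hF.2 4 (by decide)
    have hi := index_le hu.le hv
    have hun : u * n ≤ n * n := Nat.mul_le_mul_right n hu.le
    have hgle : ∀ s' v', v' < n → gainTable (s.arr 1) (s.arr 4) n s' v' ≤ n + 1 :=
      fun s' v' hv' => gainTable_le hD hv'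
    refine Ends.mono (Ends.cond (T := 2 + (((n + 0) * (40 + 10) + 8) + 7)) (T' := 17) ?_
      (fun hne => ?_) fun heq => ?_) (by simp only [cost, add_zero]; omega) fun _ h => h
    · simp only [Fits, h5]
      omega
    · obtain ⟨m, rfl⟩ : ∃ m, u = m + 1 :=
        Nat.exists_eq_succ_of_ne_zero (by simpa [eval, h5] using hne)
      refine Ends.seq (Ends.assign (by simp [Fits]) (Ends.seq (Ends.mono (Ends.forLoop (n := n)
        (fun i s' => s'.var 12 = (range i).sup fun u => s.arr 1 (u * n + v) *
          (gainTable (s.arr 1) (s.arr 4) n m u - s.arr 4 (u * n + v))) ?_ (by decide)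
        (by decide) (by decide) (by omega) ?_ ?_) le_rfl ?_)))
      · simpa using h0
      · simp [eval]
      · intro i hi s2 h20 h211 hF2 hI
        simp only [add_zero] at hi
        have f5 : s2.var 5 = m + 1 := by rw [hF2.1 5 (by decide)]; simpa using h5
        have f6 : s2.var 6 = v := by rw [hF2.1 6 (by decide)]; simpa using h6
        have a1 : s2.arr 1 = s.arr 1 := by rw [hF2.2 1 (by decide)]; exact e1
        have a4 : s2.arr 4 = s.arr 4 := by rw [hF2.2 4 (by decide)]; exact e4
        have a5 : s2.arr 5 = s1.arr 5 := by rw [hF2.2 5 (by decide)]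
        have hp := hprev m (by omega) i hi
        have hmn : m * n ≤ n * n := Nat.mul_le_mul_right n (by omega)
        have hmi := index_le (show m ≤ n by omega) hi
        have hle : s2.var 12 ≤ n + 1 := by
          rw [hI]
          refine Finset.sup_le fun k hk => ?_
          have hk : k < n := (Finset.mem_range.1 hk).trans hi
          exact (Nat.mul_le_mul (hD k hk v hv) ((Nat.sub_le _ _).trans (hgle m k hk))).trans
            (by simp)
        set z := s.arr 1 (i * n + v) *
          (gainTable (s.arr 1) (s.arr 4) n m i - s.arr 4 (i * n + v)) with hz
        have hzle : z ≤ n + 1 :=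
          (Nat.mul_le_mul (hD i hi v hv) ((Nat.sub_le _ _).trans (hgle m i hi))).trans (by simp)
        have hev : (mul (cell 1 (Expr.var 11) (Expr.var 6))
            (sub (cell 5 (sub (Expr.var 5) (const 1)) (Expr.var 11))
              (cell 4 (Expr.var 11) (Expr.var 6)))).eval s2 = z := by
          simp only [eval, cell, h20, h211, f5, f6, a1, a4, a5, Nat.add_sub_cancel, hp, hz]
        refine Ends.mono (Ends.seq (Ends.assign ?_ (Ends.cond (T := 2) (T' := 1) ?_
          (fun hlt => Ends.assign ?_ ?_) fun hlt => Ends.skip ?_))) (by simp [cell, cost])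
          fun _ h => h
        · refine ⟨?_, ⟨?_, ?_⟩, ?_⟩
          · exact fits_cell h20 h211 f6 hi.le hv hW
              (by rw [a1]; exact (hD i hi v hv).trans (by omega))
          · simp only [cell, Fits, eval, f5, h20, h211, Nat.add_sub_cancel, a5, hp]
            refine ⟨⟨⟨⟨?_, ?_⟩, ?_, ?_⟩, ?_, ?_⟩, (hgle m i hi).trans ?_⟩ <;> omega
          · exact fits_cell h20 h211 f6 hi.le hv hW
              (by rw [a4]; exact (hw i (by omega) v hv).trans (by omega))
          · rw [show _ * _ = _ from hev]
            omega
        · simp [Fits, hev]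
          omega
        · simp [Fits, hev]
          omega
        · simp only [eval, cell, h20, h211, f5, f6, a1, a4, a5, Nat.add_sub_cancel, hp, ← hz,
            Function.update_self, ne_eq, Function.update_of_ne, Nat.reduceEqDiff,
            not_false_eq_true] at hlt ⊢
          rw [range_add_one, sup_insert, ← hI, ← hz]
          have : s2.var 12 < z := by
            by_contra hc
            simp [hc] at hlt
          exact (sup_of_le_left this.le).symm
        · simp only [eval, cell, h20, h211, f5, f6, a1, a4, a5, Nat.add_sub_cancel, hp, ← hz,
            Function.update_self, ne_eq, Function.update_of_ne, Nat.reduceEqDiff,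
            not_false_eq_true] at hlt ⊢
          rw [range_add_one, sup_insert, ← hI, ← hz]
          have : z ≤ s2.var 12 := by
            by_contra hc
            simp [not_le.1 hc] at hlt
          exact (sup_of_le_right this).symm
      · rintro s2 ⟨hI, hF2⟩
        have f0 : s2.var 0 = n := by rw [hF2.1 0 (by decide)]; simpa using h0
        have f5 : s2.var 5 = m + 1 := by rw [hF2.1 5 (by decide)]; simpa using h5
        have f6 : s2.var 6 = v := by rw [hF2.1 6 (by decide)]; simpa using h6
        have a5 : s2.arr 5 = s1.arr 5 := hF2.2 5 (by decide)
        have e12 : s2.var 12 = gainTable (s.arr 1) (s.arr 4) n (m + 1) v := hI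
        have hle := hgle (m + 1) v hv
        refine Ends.mono (Ends.write ?_ ?_ ?_) (by simp [cost]) fun _ h => h
        · simp only [Fits, eval, f0, f5, f6]
          omega
        · simp only [Fits, e12]
          omega
        · simp only [eval, f0, f5, f6, e12, a5, Function.update_self]
    · obtain rfl : u = 0 := by simpa [eval, h5] using heq
      refine Ends.mono (Ends.write ?_ ?_ ?_) (by simp [cell, cost]) fun _ h => h
      · simp only [Fits, eval, h0, h5, h6]
        omega
      · refine ⟨?_, ?_⟩
        · simp only [Fits, eval, h0]
          omega
        · exact fits_cell h0 h0 h6 le_rfl hv hW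
            (by rw [e4]; exact (hw n (by omega) v hv).trans (by omega))
      · simp only [eval, cell, h0, h5, h6, e4, Function.update_self, gainTable]
  · rintro s' ⟨h1, h2⟩
    exact ⟨fun u hu => h1 u hu, h2.mono (by decide) (by decide)⟩

/-- Compare the fraction in the variables `1`, `2` with the one that belongs to an entry of the
array `5`. -/
def bestBody : Prog :=
  seq (assign 12 (cell 5 (Expr.var 5) (Expr.var 6)))
    (seq (assign 13 (add (add (Expr.var 5) (const 1))
        (sub (add (Expr.var 0) (const 1)) (Expr.var 12))))
      (cond (Expr.var 12)
        (cond (lt (mul (Expr.var 1) (Expr.var 13))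
            (mul (add (Expr.var 5) (const 1)) (Expr.var 2)))
          (seq (assign 1 (add (Expr.var 5) (const 1))) (assign 2 (Expr.var 13))) skip)
        skip))

/-- The fraction `p / q` is the best one among those that belong to the entries of the table `g`
that satisfy `R`; it is `0 / 1` if there are none. -/
structure IsBest (g : ℕ → ℕ → ℕ) (n : ℕ) (R : ℕ → ℕ → Prop) (p q : ℕ) : Prop where
  pos : 0 < q
  num_le : p ≤ n
  den_le : q ≤ 2 * n + 1
  attained : p = 0 ∧ q = 1 ∨
    ∃ s v, v < n ∧ 0 < g s v ∧ p = s + 1 ∧ q = s + 1 + (n + 1 - g s v)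
  max : ∀ s v, v < n → R s v → 0 < g s v → (s + 1) * q ≤ p * (s + 1 + (n + 1 - g s v))

theorem IsBest.mono {g : ℕ → ℕ → ℕ} {n p q : ℕ} {R R' : ℕ → ℕ → Prop} (h : IsBest g n R p q)
    (hR : ∀ s v, v < n → R' s v → 0 < g s v → R s v) : IsBest g n R' p q :=
  ⟨h.pos, h.num_le, h.den_le, h.attained, fun s v hv h1 h2 => h.max s v hv (hR s v hv h1 h2) h2⟩

theorem ends_bestBody {g : ℕ → ℕ → ℕ} {R : ℕ → ℕ → Prop} {u v : ℕ} (hn : s.var 0 = n)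
    (hu : u < n) (hv : v < n) (h5 : s.var 5 = u) (h6 : s.var 6 = v)
    (hg : s.arr 5 (u * n + v) = g u v) (hgle : g u v ≤ n + 1)
    (hW : 10 * (n * n) + 10 * n + 10 ≤ W) (h : IsBest g n R (s.var 1) (s.var 2)) :
    Ends W bestBody s 50 fun s' =>
      IsBest g n (fun a b => R a b ∨ a = u ∧ b = v) (s'.var 1) (s'.var 2) := by
  have e1 : (cell 5 (Expr.var 5) (Expr.var 6)).eval s = g u v := by
    simp only [cell, eval, h5, h6, hn, hg]
  have hp := h.num_le
  have hq := h.den_le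
  have hnn : n ≤ n * n := Nat.le_mul_self n
  have hz : (add (add (Expr.var 5) (const 1)) (sub (add (Expr.var 0) (const 1))
      (Expr.var 12))).eval { s with var := Function.update s.var 12 (g u v) } =
      u + 1 + (n + 1 - g u v) := by
    simp [eval, h5, hn]
  have hun : u * n ≤ n * n := Nat.mul_le_mul_right n hu.le
  -- The cross products are the largest numbers handled here; words of size O(n²) suffice.
  have hpz : s.var 1 * (u + 1 + (n + 1 - g u v)) ≤ n * (2 * n + 1) :=
    Nat.mul_le_mul hp (by omega)
  have huq : (u + 1) * s.var 2 ≤ n * (2 * n + 1) := Nat.mul_le_mul hu hq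
  have hnn' : n * (2 * n + 1) = 2 * (n * n) + n := by ring
  refine Ends.mono (T := 7 + (10 + (2 + 16))) (Ends.seq (Ends.assign ?_ ?_)) (by norm_num)
    fun _ h => h
  · exact fits_cell hn h5 h6 hu.le hv hW (by omega)
  rw [e1]
  refine Ends.seq (Ends.assign ?_ ?_)
  · refine ⟨⟨?_, ?_, ?_⟩, ⟨⟨?_, ?_, ?_⟩, ?_⟩, (le_of_eq hz).trans (by omega)⟩ <;>
      simp [Fits, eval, h5, hn] <;> omega
  rw [hz]
  refine Ends.mono (Ends.cond (T := 16) (T' := 1) ?_ (fun hpos => ?_) fun hzero => ?_)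
    (by simp [cost]) fun _ h => h
  · simp only [Fits, Function.update_self, ne_eq, Function.update_of_ne, Nat.reduceEqDiff,
      not_false_eq_true]
    omega
  · have hpos : 0 < g u v := by
      refine Nat.pos_of_ne_zero fun h0 => hpos ?_
      simp [eval, h0]
    refine Ends.mono (Ends.cond (T := 6) (T' := 1) ?_ (fun hlt => ?_) fun hlt => ?_)
      (by simp [cost]) fun _ h => h
    · refine ⟨⟨?_, ?_, ?_⟩, ⟨⟨?_, ?_, ?_⟩, ?_, ?_⟩, ?_⟩ <;>
        (try simp [Fits, eval, h5]) <;> omega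
    · have hlt : s.var 1 * (u + 1 + (n + 1 - g u v)) < (u + 1) * s.var 2 := by
        by_contra hc
        simp [eval, h5, hc] at hlt
      refine Ends.mono (T := 4 + 2) (Ends.seq (Ends.assign ?_ (Ends.assign ?_ ?_))) le_rfl
        fun _ h => h
      · simp [Fits, eval, h5]
        omega
      · simp [Fits]
        omega
      · simp only [eval, h5, Function.update_self, ne_eq, Function.update_of_ne,
          Nat.reduceEqDiff, not_false_eq_true]
        refine ⟨by omega, hu, by omega, Or.inr ⟨u, v, hv, hpos, rfl, rfl⟩, ?_⟩
        rintro a b hb (hR | ⟨rfl, rfl⟩) hab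
        · have h1 := h.max a b hb hR hab
          -- Transitivity of the comparison of fractions, with the old denominator cancelled.
          refine Nat.le_of_mul_le_mul_left ?_ h.pos
          calc s.var 2 * ((a + 1) * (u + 1 + (n + 1 - g u v)))
              = (a + 1) * s.var 2 * (u + 1 + (n + 1 - g u v)) := by ring
            _ ≤ s.var 1 * (a + 1 + (n + 1 - g a b)) * (u + 1 + (n + 1 - g u v)) :=
                Nat.mul_le_mul_right _ h1
            _ = s.var 1 * (u + 1 + (n + 1 - g u v)) * (a + 1 + (n + 1 - g a b)) := by ring
            _ ≤ (u + 1) * s.var 2 * (a + 1 + (n + 1 - g a b)) :=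
                Nat.mul_le_mul_right _ hlt.le
            _ = s.var 2 * ((u + 1) * (a + 1 + (n + 1 - g a b))) := by ring
        · exact le_rfl
    · have hle : (u + 1) * s.var 2 ≤ s.var 1 * (u + 1 + (n + 1 - g u v)) := by
        by_contra hc
        simp [eval, h5, not_le.1 hc] at hlt
      refine Ends.skip ?_
      simp only [ne_eq, Function.update_of_ne, Nat.reduceEqDiff, not_false_eq_true]
      refine ⟨h.pos, h.num_le, h.den_le, h.attained, ?_⟩
      rintro a b hb (hR | ⟨rfl, rfl⟩) hab
      · exact h.max a b hb hR hab
      · exact hle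
  · have hzero : g u v = 0 := by simpa [eval] using hzero
    refine Ends.skip ?_
    simp only [ne_eq, Function.update_of_ne, Nat.reduceEqDiff, not_false_eq_true]
    refine h.mono ?_
    rintro a b hb (hR | ⟨rfl, rfl⟩) hab
    · exact hR
    · omega

/-- Compute the best fraction of the array `5` in the variables `1`, `2`. -/
def best : Prog :=
  seq (assign 1 (const 0)) (seq (assign 2 (const 1)) (forLoop 5 0 (forLoop 6 0 bestBody)))

theorem ends_best {g : ℕ → ℕ → ℕ} (hn : s.var 0 = n)
    (hg : ∀ u < n, ∀ v < n, s.arr 5 (u * n + v) = g u v)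
    (hgle : ∀ u < n, ∀ v < n, g u v ≤ n + 1) (hW : 10 * (n * n) + 10 * n + 10 ≤ W) :
    Ends W best s (n * (n * 60 + 18) + 12) fun s' =>
      IsBest g n (fun u _ => u < n) (s'.var 1) (s'.var 2) := by
  refine Ends.mono (T := 2 + (2 + ((n + 0) * (((n + 0) * (50 + 10) + 8) + 10) + 8)))
    (Ends.seq (Ends.assign (by simp [Fits]) (Ends.seq (Ends.assign ?_
      (Ends.mono (Ends.forLoop (n := n)
        (fun i s' => IsBest g n (fun a _ => a < i) (s'.var 1) (s'.var 2)) ?_ (by decide)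
        (by decide) (by decide) (by omega) ?_ ?_) le_rfl ?_)))))
    (le_of_eq (by ring)) fun _ h => h
  · simp only [Fits]
    omega
  · simpa using hn
  · simp only [eval, Function.update_self, ne_eq, Function.update_of_ne, Nat.reduceEqDiff,
      not_false_eq_true]
    exact ⟨by omega, by omega, by omega, Or.inl ⟨rfl, rfl⟩, fun _ _ _ h => absurd h (by omega)⟩
  · intro i hi s1 h10 h15 hF1 hI
    refine (Ends.forLoop (n := n) (c := 0) (fun j s' => IsBest g n
      (fun a b => a < i ∨ a = i ∧ b < j) (s'.var 1) (s'.var 2)) h10 (by decide)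
      (by decide) (by decide) (by omega) ?_ ?_).mono le_rfl ?_
    · exact hI.mono fun a b _ h _ => by omega
    · intro j hj s2 h20 h26 hF2 hI2
      have e5 : s2.var 5 = i := (hF2.1 5 (by decide)).trans h15
      have a5 : s2.arr 5 = s.arr 5 := (hF2.2 5 (by decide)).trans (hF1.2 5 (by decide))
      refine (ends_bestBody h20 hi hj e5 h26 (by rw [a5]; exact hg i hi j hj)
        (hgle i hi j hj) hW hI2).mono le_rfl fun s3 h3 => ?_
      simp only [ne_eq, Function.update_of_ne, Nat.reduceEqDiff, not_false_eq_true]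
      exact h3.mono fun a b _ h _ => by omega
    · rintro s2 ⟨hI2, -⟩
      simp only [ne_eq, Function.update_of_ne, Nat.reduceEqDiff, not_false_eq_true]
      exact hI2.mono fun a b hb h _ => by omega
  · rintro s1 ⟨h1, -⟩
    exact h1

/-- Compute the tensor capacity in the variables `3`, `4` from `a(G)`. -/
def capacity : Prog :=
  cond (lt (Expr.var 2) (add (Expr.var 1) (Expr.var 1)))
    (seq (assign 3 (const 1)) (assign 4 (const 1)))
    (seq (assign 3 (Expr.var 1)) (assign 4 (Expr.var 2)))

/-- The test q < 2p means p/q > 1/2, the threshold beyond which the capacity is 1. -/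
theorem ends_capacity {p q : ℕ} (h1 : s.var 1 = p) (h2 : s.var 2 = q) (hW : 2 * p + q + 1 ≤ W) :
    Ends W capacity s 10 fun s' => s'.var 1 = p ∧ s'.var 2 = q ∧
      (q < 2 * p ∧ s'.var 3 = 1 ∧ s'.var 4 = 1 ∨ 2 * p ≤ q ∧ s'.var 3 = p ∧ s'.var 4 = q) := by
  refine Ends.mono (Ends.cond (T := 2 + 2) (T' := 2 + 2) ?_
    (fun hlt => Ends.seq (Ends.assign ?_ (Ends.assign ?_ ?_)))
    fun hlt => Ends.seq (Ends.assign ?_ (Ends.assign ?_ ?_))) (by simp [cost]) fun _ h => h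
  · simp only [Fits, eval, h1, h2]
    omega
  · simp only [Fits]
    omega
  · simp only [Fits]
    omega
  · have : q < 2 * p := by
      by_contra hc
      have : ¬ q < p + p := by omega
      simp [eval, h1, h2, this] at hlt
    simp [eval, h1, h2, this]
  · simp only [Fits]
    omega
  · simp [Fits]
    omega
  · have : 2 * p ≤ q := by
      by_contra hc
      have : q < p + p := by omega
      simp [eval, h1, h2, this] at hlt
    simp [eval, h1, h2, this]

/-- The program that computes `a(G)` and the tensor capacity of a permutation graph. -/
def tensorCapacityProg : Prog :=
  seq orient (seq (forLoop 5 1 (forLoop 6 0 weightBody))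
    (seq (forLoop 5 0 (forLoop 6 0 gainBody)) (seq best capacity)))

/-! ### Meaning of the tables and assembly of the program -/

open SimpleGraph Classical in
/-- The tables of the program hold the numbers `chainGain`. -/
theorem gainTable_eq_chainGain {G : SimpleGraph (Fin n)} {Dp : Fin n × Fin n → Prop}
    {A D w : ℕ → ℕ} (hA : ∀ u v : Fin n, A (u * n + v) = if G.Adj u v then 1 else 0)
    (hA0 : ∀ m, n * n ≤ m → A m = 0)
    (hD : ∀ u v : Fin n, D (u * n + v) = if Dp (u, v) then 1 else 0)
    (hw : ∀ u < n + 1, ∀ v < n, w (u * n + v) = weightTable A n u v) (s : ℕ) (v : Fin n) :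
    gainTable D w n s v = G.chainGain Dp s v := by
  have hdeg : ∀ v : Fin n, w (n * n + v) = #(univ.filter fun k => G.Adj v k) := by
    intro v
    rw [hw n (by omega) v v.2, weightTable, Finset.sum_range, card_filter]
    refine sum_congr rfl fun k _ => ?_
    -- Row n lies past the matrix, where the memory is 0: comparison with an empty neighbourhood
    -- yields the degree.
    rw [hA0 _ (by omega), hA]
    by_cases h : G.Adj v k <;> simp [h]
  have hnew : ∀ u v : Fin n, w (u * n + v) = #(univ.filter fun k => ¬ G.Adj u k ∧ G.Adj v k) := by
    intro u v
    rw [hw u (by omega) v v.2, weightTable, Finset.sum_range, card_filter]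
    refine sum_congr rfl fun k _ => ?_
    rw [hA, hA]
    by_cases h : G.Adj v k <;> by_cases h' : G.Adj u k <;> simp [h, h']
  induction s generalizing v with
  | zero => rw [gainTable, chainGain, hdeg, Fintype.card_fin]
  | succ s ih =>
    rw [gainTable, chainGain]
    have hterm : ∀ u : Fin n, D (u * n + v) * (gainTable D w n s u - w (u * n + v)) =
        if Dp (u, v) then
          G.chainGain Dp s u - #(univ.filter fun k => ¬ G.Adj u k ∧ G.Adj v k) else 0 := by
      intro u
      rw [hD, ih, hnew]
      by_cases h : Dp (u, v) <;> simp [h]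
    apply le_antisymm
    · refine Finset.sup_le fun u hu => ?_
      have := hterm ⟨u, Finset.mem_range.1 hu⟩
      simp only at this
      rw [this]
      exact le_sup (f := fun u => if Dp (u, v) then
        G.chainGain Dp s u - #(univ.filter fun k => ¬ G.Adj u k ∧ G.Adj v k) else 0) (mem_univ _)
    · refine Finset.sup_le fun u _ => ?_
      rw [← hterm u]
      exact le_sup (f := fun u => D (u * n + v) * (gainTable D w n s u - w (u * n + v)))
        (Finset.mem_range.2 u.2)

theorem input_arr_le {G : SimpleGraph (Fin n)} (m : ℕ) : (input G).arr 0 m ≤ 1 := by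
  simp only [input]
  split_ifs <;> simp

theorem input_arr_eq_zero {G : SimpleGraph (Fin n)} (m : ℕ) (hm : n * n ≤ m) :
    (input G).arr 0 m = 0 := by
  simp only [input]
  rw [if_neg]
  rintro ⟨-, i, j, rfl, -⟩
  have h1 : ((i : ℕ) + 1) * n ≤ n * n := Nat.mul_le_mul_right n i.2
  have h2 := j.2
  rw [add_mul] at h1
  omega

open Classical in
theorem holds_input (G : SimpleGraph (Fin n)) : Holds G [] (input G) := by
  refine ⟨by simp [input], fun u v => ?_, by simp, by simp [input], by simp [input], by simp⟩
  simp only [input, true_and]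
  congr 1
  refine propext ⟨?_, fun h => ⟨u, v, rfl, h⟩⟩
  rintro ⟨i, j, h, hij⟩
  have := fin_index_inj.1 h
  rw [Prod.mk.injEq] at this
  rwa [this.1, this.2]

end RAM

open RAM SimpleGraph Finset in
theorem mainTheorem11 :
    ∃ (P : RAM.Prog) (C d : ℕ), ∀ (n : ℕ), 1 ≤ n → ∀ (G : SimpleGraph (Fin n)),
      G.IsPermutationGraph →
        ∃ (t : ℕ) (s : RAM.State),
          RAM.Run (C * n ^ d) P (RAM.input G) t s ∧ t ≤ C * n ^ 3 ∧
          s.var 2 ≠ 0 ∧ G.IsMaxNbhdRatio ((s.var 1 : ℝ) / (s.var 2 : ℝ)) ∧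
          s.var 4 ≠ 0 ∧ G.IsTensorCapacity ((s.var 3 : ℝ) / (s.var 4 : ℝ)) := by
  -- The step bounds add up to 256n³ + 487n² + 225n + 64, at most 1032n³ for n ≥ 1, so 2000 is
  -- generous.
  refine ⟨tensorCapacityProg, 2000, 3, fun n hn G hG => ?_⟩
  obtain ⟨D₀, hD₀⟩ := hG.exists_isCoOrder
  set W := 2000 * n ^ 3 with hWdef
  have hn2 : n ≤ n ^ 2 := Nat.le_self_pow (by norm_num) n
  have hn3 : n ^ 2 ≤ n ^ 3 := Nat.pow_le_pow_right hn (by norm_num)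
  have hnn : n * n = n ^ 2 := (sq n).symm
  have hW : 10 * (n * n) + 10 * n + 10 ≤ W := by omega
  have main : Ends W tensorCapacityProg (input G) (2000 * n ^ 3) fun s =>
      s.var 2 ≠ 0 ∧ G.IsMaxNbhdRatio ((s.var 1 : ℝ) / (s.var 2 : ℝ)) ∧
        s.var 4 ≠ 0 ∧ G.IsTensorCapacity ((s.var 3 : ℝ) / (s.var 4 : ℝ)) := by
    refine Ends.mono (Ends.seq ((ends_orient hD₀ hW (holds_input G) (by simp [input])
      (by simp [input]) (by simp [input])).frame.mono le_rfl ?_))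
      (T := (n * (n + 1) + n + n * n) * (n * 90 + 72) + 8 +
        (((n + 1) * (n * (n * 26 + 27) + 18) + 8) +
          ((n * (n * (n * 50 + 50) + 18) + 8) + ((n * (n * 60 + 18) + 12) + 10)))) ?_ fun _ h => h
    swap
    · have : (n * (n + 1) + n + n * n) * (n * 90 + 72) + 8 +
        (((n + 1) * (n * (n * 26 + 27) + 18) + 8) +
          ((n * (n * (n * 50 + 50) + 18) + 8) + ((n * (n * 60 + 18) + 12) + 10))) =
          256 * n ^ 3 + 487 * n ^ 2 + 225 * n + 64 := by ring
      omega
    rintro s1 ⟨⟨L, hL, hlex⟩, hF1⟩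
    have hD := hlex.isCoOrder
    have hA1 : s1.arr 0 = (input G).arr 0 := hF1.2 0 (by decide)
    refine Ends.seq ((ends_weights hL.size (fun m => by rw [hA1]; exact input_arr_le m) hW).mono
      le_rfl ?_)
    rintro s2 ⟨hw2, hF2⟩
    have e20 : s2.var 0 = n := (hF2.1 0 (by decide)).trans hL.size
    have a21 : s2.arr 1 = s1.arr 1 := hF2.2 1 (by decide)
    have hD2 : ∀ u < n, ∀ v < n, s2.arr 1 (u * n + v) ≤ 1 := by
      intro u hu v hv
      rw [a21, hL.mem ⟨u, hu⟩ ⟨v, hv⟩]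
      split_ifs <;> simp
    refine Ends.seq ((ends_gains e20 hD2 (fun u hu v hv => by
      rw [hw2 u hu v hv]; exact weightTable_le _ _ _ _) hW).mono le_rfl ?_)
    rintro s3 ⟨hg3, hF3⟩
    have e30 : s3.var 0 = n := (hF3.1 0 (by decide)).trans e20
    refine Ends.seq ((ends_best e30 hg3 (fun u hu v hv => gainTable_le hD2 hv) hW).mono
      le_rfl ?_)
    intro s4 hbest
    have hgain := gainTable_eq_chainGain (Dp := fun p => p ∈ L) hL.adj
      (fun m hm => by rw [hA1]; exact input_arr_eq_zero m hm) (D := s2.arr 1)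
      (fun u v => by rw [a21, hL.mem u v]; congr) hw2
    have hp := hbest.num_le
    have hq := hbest.den_le
    refine (ends_capacity rfl rfl (by omega)).mono le_rfl ?_
    rintro s5 ⟨h1, h2, h34⟩
    -- A single vertex is a chain with positive gain, so the default fraction 0/1 does not survive.
    have hpos0 : 0 < gainTable (s2.arr 1) (s2.arr 4) n 0 0 := by
      have := hw2 n (by omega) 0 (by omega)
      have h' := weightTable_le (s1.arr 0) n n 0
      rw [gainTable, this]
      omega
    obtain ⟨u, v, hv, hgpos, hpu, hqu⟩ := hbest.attained.resolve_left (by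
      rintro ⟨hp0, hq0⟩
      have := hbest.max 0 0 (by omega) (by omega) hpos0
      rw [hp0, hq0] at this
      omega)
    rw [show v = ((⟨v, hv⟩ : Fin n) : ℕ) from rfl, hgain] at hgpos hqu
    obtain ⟨I, hne, hI, hexp, hpI, hqI⟩ := exists_optimal_of_chainGain
      (q := s4.var 2) hD hgpos hpu
      (by rw [Fintype.card_fin]; exact hqu) (by
        intro s' v' hs' hpos'
        rw [Fintype.card_fin] at hs' ⊢
        rw [← hgain] at hpos' ⊢
        exact hbest.max s' v' v'.2 hs' hpos')
    have hIpos := card_pos.2 hne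
    have hratio : (s4.var 1 : ℝ) / (s4.var 2 : ℝ) = (#I : ℝ) / (#I + #(relNbhd G.Adj I)) := by
      rw [hpI, hqI]
      push_cast
      rfl
    refine ⟨by omega, ?_, ?_, ?_⟩
    · rw [h1, h2, hratio]
      exact G.isMaxNbhdRatio_of_expands hI hne hexp
    · rcases h34 with ⟨-, -, h4⟩ | ⟨-, -, h4⟩ <;> omega
    · rcases h34 with ⟨hlt, h3, h4⟩ | ⟨hle, h3, h4⟩
      · rw [h3, h4, Nat.cast_one, div_one]
        exact G.isTensorCapacity_one hI (by omega)
      · rw [h3, h4, hratio]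
        exact G.isTensorCapacity_of_le hI hne (by omega) hexp
  obtain ⟨t, s, hrun, ht, hs⟩ := main
  exact ⟨t, s, hrun, ht, hs⟩
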